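/- A string $s$ of length $n$ is a sequence $s[1],\dots,s[n]$ of letters that are integers in $[0..n]$; $\sigma(s)$ denotes the number of its distinct letters. All logarithms have base $2$ unless another base is shown. An *LZ77 parsing* of $s$ is a factorization $s=f_1f_2\cdots f_k$ into non-empty phrases such that, for each $i$, either $|f_i|=1$, or $|f_i|>1$ and $f_i[1..|f_i|-1]$ has an occurrence in $s$ starting at some position $j\le |f_1\cdots f_{i-1}|$ (possibly overlapping $f_i$). The *greedy* LZ77 parsing is the one in which each phrase, from left to right, is as long as possible; $z(s)$ denotes the number of its phrases. Fix three encoders $e_d,e_\ell,e_c$ mapping non-negative integers to bit strings, each of which maps every positive integer $x$ to a bit string of length $\Theta(\log(x+1))$. An LZ77 encoding corresponding to a parsing is the concatenation of the bit strings $e_d(d)e_\ell(\ell)e_c(c)$ over its phrases $f_i$, where $\ell=|f_i|$, $c$ is the last letter of $f_i$, and $d=|f_1\cdots f_{i-1}|-j$ for some position $j \le |f_1\cdots f_{i-1}|$ of an occurrence of $f_i[1..|f_i|-1]$ if $|f_i|>1$, and $d=0$ if $|f_i|=1$. Let $\mathsf{LZ_{opt}}(s)$ be the minimal size in bits of an LZ77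 encoding of $s$ over all LZ77 parsings, and $\mathsf{LZ_{gr}}(s)$ the minimal size over the encodings corresponding to the greedy parsing. **Corollary 2.** Let $\epsilon\in(0,1)$ and $C>0$ be fixed. 1. (Upper bound.) There is a constant $K>0$, depending only on $\epsilon$, $C$ and the encoders, such that every string $s$ of length $n\ge 3$ with $\sigma(s)\le\log^{C}n$ and $z(s)\ge 2^{\log^{\epsilon}n}$ satisfies $\mathsf{LZ_{opt}}(s)>0$ and $$\frac{\mathsf{LZ_{gr}}(s)}{\mathsf{LZ_{opt}}(s)}\le K\,\frac{\log n}{\log\log n}.$$ 2. (Tightness.) There are constants $c,a,b>0$ and $N$, depending only on $\epsilon$, $C$ and the encoders, such that for all integers $n\ge N$, $\sigma$ and $z$ with $2\le\sigma\le\log^{C}n$ and $2^{\log^{\epsilon}n}\le z\le \frac{n}{\log_\sigma n}$ there is a string $s$ of length $n$ with $\sigma(s)=\sigma$, $\;a z\le z(s)\le b z$, $\;z(s)\ge 2^{\log^{\epsilon}n}$, and $$\frac{\mathsf{LZ_{gr}}(s)}{\mathsf{LZ_{opt}}(s)}\ge c\,\frac{\log n}{\log\log n}.$$ -/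

import Mathlib

namespace LZ77

/-- `u` occurs in `s` starting at position `j`; positions are numbered from `1`. -/
def OccursAt (u s : List ℕ) (j : ℕ) : Prop :=
  1 ≤ j ∧ u <+: s.drop (j - 1)

/-- `f` may be used as an LZ77 phrase of `s` right after the prefix of `s` of length `p`: it is a
nonempty substring starting at position `p + 1`, and either it is a letter or the string `f` without
its last letter has an occurrence starting at some position `j ≤ p` (which may overlap `f`). -/
def IsPhrase (s : List ℕ) (p : ℕ) (f : List ℕ) : Prop :=
  f <+: s.drop p ∧
    (f.length = 1 ∨ (1 < f.length ∧ ∃ j, j ≤ p ∧ OccursAt f.dropLast s j))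

/-- A longest possible phrase at the given place. -/
def IsGreedyPhrase (s : List ℕ) (p : ℕ) (f : List ℕ) : Prop :=
  IsPhrase s p f ∧ ∀ g, IsPhrase s p g → g.length ≤ f.length

/-- The total length of the first `i` phrases. -/
def start (P : List (List ℕ)) (i : ℕ) : ℕ := (P.take i).flatten.length

/-- `P` is an LZ77 parsing of `s`. -/
def IsParsing (s : List ℕ) (P : List (List ℕ)) : Prop :=
  P.flatten = s ∧ ∀ (i : ℕ) (hi : i < P.length), IsPhrase s (start P i) P[i]

/-- `P` is the LZ77 parsing of `s` in which every phrase is as long as possible. -/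
def IsGreedyParsing (s : List ℕ) (P : List (List ℕ)) : Prop :=
  P.flatten = s ∧ ∀ (i : ℕ) (hi : i < P.length), IsGreedyPhrase s (start P i) P[i]

theorem start_zero (P : List (List ℕ)) : start P 0 = 0 := by simp [start]

theorem start_cons (f : List ℕ) (P : List (List ℕ)) (i : ℕ) :
    start (f :: P) (i + 1) = f.length + start P i := by simp [start]

theorem exists_greedyPhrase (s : List ℕ) (p : ℕ) (hp : p < s.length) :
    ∃ f, IsGreedyPhrase s p f := by
  classical
  have h1 : IsPhrase s p ((s.drop p).take 1) := by
    refine ⟨List.take_prefix _ _, Or.inl ?_⟩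
    simp; omega
  let Q : ℕ → Prop := fun l => ∃ f, IsPhrase s p f ∧ f.length = l
  have hb : ∀ l, Q l → l ≤ s.length := by
    rintro l ⟨f, hf, rfl⟩
    have := hf.1.length_le
    simp at this; omega
  have hQ : Q (Nat.findGreatest Q s.length) :=
    Nat.findGreatest_spec (hb _ ⟨_, h1, rfl⟩) ⟨_, h1, rfl⟩
  obtain ⟨f, hf, hl⟩ := hQ
  refine ⟨f, hf, fun g hg => ?_⟩
  rw [hl]
  exact Nat.le_findGreatest (hb _ ⟨g, hg, rfl⟩) ⟨g, hg, rfl⟩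

theorem IsPhrase.length_pos {s : List ℕ} {p : ℕ} {f : List ℕ} (h : IsPhrase s p f) :
    0 < f.length := by
  rcases h.2 with h | h <;> omega

theorem exists_greedy_from (s : List ℕ) (k : ℕ) : ∀ p, p + k = s.length →
    ∃ P : List (List ℕ), P.flatten = s.drop p ∧
      ∀ (i : ℕ) (hi : i < P.length), IsGreedyPhrase s (p + start P i) P[i] := by
  induction k using Nat.strong_induction_on with
  | _ k ih =>
    intro p hp
    rcases Nat.eq_zero_or_pos k with rfl | hk
    · exact ⟨[], by simp [← hp], by simp⟩
    · obtain ⟨f, hf⟩ := exists_greedyPhrase s p (by omega)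
      have hpos := hf.1.length_pos
      have hle := hf.1.1.length_le
      simp only [List.length_drop] at hle
      obtain ⟨P, hP, hg⟩ := ih (k - f.length) (by omega) (p + f.length) (by omega)
      refine ⟨f :: P, ?_, ?_⟩
      · obtain ⟨t, ht⟩ := hf.1.1
        have h2 : t = s.drop (p + f.length) := by
          rw [← List.drop_drop, ← ht]; simp
        rw [List.flatten_cons, hP, ← h2, ht]
      · rintro (_ | i) hi
        · simpa [start_zero] using hf
        · rw [start_cons, ← add_assoc]
          simpa using hg i (by simpa using hi)

theorem greedy_from_unique (s : List ℕ) (P : List (List ℕ)) : ∀ (Q : List (List ℕ)) (p : ℕ),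
    P.flatten = Q.flatten →
    (∀ (i : ℕ) (hi : i < P.length), IsGreedyPhrase s (p + start P i) P[i]) →
    (∀ (i : ℕ) (hi : i < Q.length), IsGreedyPhrase s (p + start Q i) Q[i]) → P = Q := by
  induction P with
  | nil =>
    rintro (_ | ⟨g, Q⟩) p h - hQ
    · rfl
    · have := (hQ 0 (by simp)).1.length_pos
      simp only [List.flatten_nil, List.flatten_cons, List.nil_eq, List.append_eq_nil_iff] at h
      simp [h.1] at this
  | cons f P ih =>
    rintro (_ | ⟨g, Q⟩) p h hP hQ
    · have := (hP 0 (by simp)).1.length_pos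
      simp only [List.flatten_nil, List.flatten_cons, List.nil_eq, List.append_eq_nil_iff] at h
      simp [h.1] at this
    · have h1 := hP 0 (by simp)
      have h2 := hQ 0 (by simp)
      simp only [start_zero, List.getElem_cons_zero] at h1 h2
      have hl : f.length = g.length := le_antisymm (h2.2 _ h1.1) (h1.2 _ h2.1)
      simp only [List.flatten_cons] at h
      obtain ⟨rfl, h'⟩ := List.append_inj h hl
      rw [ih Q (p + f.length) h' (fun i hi => ?_) (fun i hi => ?_)]
      · have := hP (i + 1) (by simpa using hi)
        rw [start_cons, ← add_assoc] at this
        simpa using this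
      · have := hQ (i + 1) (by simpa using hi)
        rw [start_cons, ← add_assoc] at this
        simpa using this

theorem existsUnique_greedyParsing (s : List ℕ) : ∃! P, IsGreedyParsing s P := by
  obtain ⟨P, h, hg⟩ := exists_greedy_from s s.length 0 (by simp)
  refine ⟨P, ⟨by simpa using h, fun i hi => by simpa using hg i hi⟩, ?_⟩
  rintro Q ⟨hQ, hg'⟩
  refine greedy_from_unique s Q P 0 (by rw [hQ, h]; rfl) (fun i hi => ?_) hg
  simpa using hg' i hi

/-- The greedy LZ77 parsing of `s`. -/
noncomputable def greedyParsing (s : List ℕ) : List (List ℕ) :=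
  (existsUnique_greedyParsing s).choose

theorem greedyParsing_spec (s : List ℕ) : IsGreedyParsing s (greedyParsing s) :=
  (existsUnique_greedyParsing s).choose_spec.1

/-- The number of phrases in the greedy LZ77 parsing. -/
noncomputable def greedyCount (s : List ℕ) : ℕ := (greedyParsing s).length

/-- The number of distinct letters of `s`. -/
def alphabetSize (s : List ℕ) : ℕ := s.toFinset.card

/-- A triple `⟨d, ℓ, c⟩` representing a phrase. -/
structure Triple where
  d : ℕ
  l : ℕ
  c : ℕ

/-- `t` represents the phrase `f` that follows the prefix of `s` of length `p`: `ℓ = |f|`, `c` is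
the last letter of `f`, and `d = 0` if `|f| = 1`, while otherwise `d = p - j` for a position `j ≤ p`
of an occurrence of `f` without its last letter. -/
def Represents (s : List ℕ) (p : ℕ) (f : List ℕ) (t : Triple) : Prop :=
  t.l = f.length ∧ f.getLast? = some t.c ∧
    ((f.length = 1 ∧ t.d = 0) ∨
      (1 < f.length ∧ ∃ j, j ≤ p ∧ OccursAt f.dropLast s j ∧ t.d = p - j))

/-- The list `T` of triples represents the phrases of the parsing `P` of `s`, one by one. -/
def RepresentsAll (s : List ℕ) (P : List (List ℕ)) (T : List Triple) : Prop :=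
  T.length = P.length ∧
    ∀ (i : ℕ) (hP : i < P.length) (hT : i < T.length), Represents s (start P i) P[i] T[i]

/-- The bit string encoding a list of triples by means of the encoders `ed`, `el`, `ec`. -/
def encode (ed el ec : ℕ → List Bool) (T : List Triple) : List Bool :=
  T.flatMap fun t => ed t.d ++ el t.l ++ ec t.c

/-- Encoders that map every positive integer `x` to a bit string of length `Θ(log (x + 1))`. -/
def IsLogEncoder (e : ℕ → List Bool) : Prop :=
  ∃ a b : ℝ, 0 < a ∧ 0 < b ∧ ∀ x : ℕ, 1 ≤ x →
    a * Real.logb 2 ((x : ℝ) + 1) ≤ ((e x).length : ℝ) ∧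
    ((e x).length : ℝ) ≤ b * Real.logb 2 ((x : ℝ) + 1)

/-- The sizes in bits of all LZ77 encodings of `s` that correspond to the parsing `P`. -/
def encodingSizes (ed el ec : ℕ → List Bool) (s : List ℕ) (P : List (List ℕ)) : Set ℕ :=
  {m | ∃ T, RepresentsAll s P T ∧ (encode ed el ec T).length = m}

/-- The size in bits of the (smallest) greedy LZ77 encoding of `s`. -/
noncomputable def LZgr (ed el ec : ℕ → List Bool) (s : List ℕ) : ℕ :=
  sInf (encodingSizes ed el ec s (greedyParsing s))

/-- The size in bits of an optimal LZ77 encoding of `s`. -/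
noncomputable def LZopt (ed el ec : ℕ → List Bool) (s : List ℕ) : ℕ :=
  sInf {m | ∃ P, IsParsing s P ∧ m ∈ encodingSizes ed el ec s P}

/-- Every parsing has an encoding, so that the infima above are minima of nonempty sets. -/
theorem encodingSizes_nonempty (ed el ec : ℕ → List Bool) {s : List ℕ} {P : List (List ℕ)}
    (h : IsParsing s P) : (encodingSizes ed el ec s P).Nonempty := by
  have key : ∀ i : Fin P.length, ∃ t, Represents s (start P i) P[i] t := by
    rintro ⟨i, hi⟩
    have hf := h.2 i hi
    have hne : P[i] ≠ [] := List.ne_nil_of_length_pos hf.length_pos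
    rcases hf.2 with h1 | ⟨h1, j, hj, ho⟩
    · exact ⟨⟨0, P[i].length, P[i].getLast hne⟩, rfl, List.getLast?_eq_some_getLast hne,
        Or.inl ⟨h1, rfl⟩⟩
    · exact ⟨⟨start P i - j, P[i].length, P[i].getLast hne⟩, rfl,
        List.getLast?_eq_some_getLast hne, Or.inr ⟨h1, j, hj, ho, rfl⟩⟩
  choose t ht using key
  refine ⟨_, List.ofFn t, ⟨by simp, fun i hP hT => ?_⟩, rfl⟩
  simpa using ht ⟨i, hP⟩

theorem greedyParsing_isParsing (s : List ℕ) : IsParsing s (greedyParsing s) :=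
  ⟨(greedyParsing_spec s).1, fun i hi => ((greedyParsing_spec s).2 i hi).1⟩

end LZ77

open Filter Asymptotics Topology

namespace LZ77

/-! Write `x = log n`. Upper bound. A greedy encoding costs at most `O(x)` bits per phrase, so it
suffices that any parsing costs at least a constant times `log x` per greedy phrase. Greedy phrases
other than the last are pairwise distinct (`IsGreedyParsing.getElem_inj`), so at most `(σ+1)^L + 1`
of them have length at most `L`. For `L = ⌊x^(ε/2)⌋` this is at most half of all phrases, since `σ ≤
x^C` and there are at least `2^(x^ε)` of them. A phrase of any other parsing meets at most two
greedy phrases (`IsGreedyParsing.card_meets_le`), and `1 + ∑ l ≤ ∏ (l+1)` shows that the lengths of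
the phrases meeting a greedy phrase longer than `L` already cost `Ω(log L)` bits together. Summing
over the long greedy phrases gives `mul_greedyCount_le_LZopt`.

Tightness. A counter with `q` digits in base `σ`, where `q = O(x)`, is written twice, with about `n`
zeros between the copies. In the second copy each block ends with one more zero, so a greedy phrase
is exactly one block copied from the first copy (`start_succ_second`). That source is forced, and
its distance of order `n` costs `Ω(x)` bits per block (`le_LZgr_hardString`). But consecutive
counter values differ by a carry: zeros in the low digits, one changed digit, the rest as before.
Hence a block splits into at most four phrases of length and distance `O(q)` (`reach_block`),
costing `O(log x)` bits. With `m` values counted, the sizes are `Ω(m x)` and `O(m log x + x)`, and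
`m ≥ 2^(x^ε) ≥ x` absorbs the last term. -/

theorem start_succ (P : List (List ℕ)) {i : ℕ} (hi : i < P.length) :
    start P (i + 1) = start P i + P[i].length := by
  simp only [start, List.take_add_one, List.flatten_append, List.length_append]
  simp [List.getElem?_eq_getElem hi]

theorem start_mono (P : List (List ℕ)) : Monotone (start P) := by
  refine monotone_nat_of_le_succ fun i => ?_
  rcases lt_or_ge i P.length with h | h
  · rw [start_succ P h]; omega
  · simp [start, List.take_of_length_le h, List.take_of_length_le (h.trans (Nat.le_succ i))]

theorem start_length (P : List (List ℕ)) : start P P.length = P.flatten.length := by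
  simp [start]

/-! ### Phrases as letterwise matches -/

theorem IsPhrase.eq_take {s f : List ℕ} {p : ℕ} (h : IsPhrase s p f) :
    f = (s.drop p).take f.length := List.prefix_iff_eq_take.1 h.1

theorem IsPhrase.add_length_le {s f : List ℕ} {p : ℕ} (h : IsPhrase s p f) :
    p + f.length ≤ s.length := by
  have h1 := h.1.length_le
  have h2 := h.length_pos
  simp at h1; omega

/-- Occurrences of a substring of `s`, letter by letter. -/
theorem occursAt_iff {s : List ℕ} {p l j : ℕ} (hp : p + l ≤ s.length) :
    OccursAt ((s.drop p).take l) s (j + 1) ↔ ∀ t < l, s[j + t]? = s[p + t]? := by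
  have hl : ((s.drop p).take l).length = l := by simp; omega
  simp only [OccursAt, List.prefix_iff_getElem?, hl, Nat.add_sub_cancel, List.getElem?_drop,
    List.getElem_take, List.getElem_drop]
  constructor
  · rintro ⟨-, h⟩ t ht
    rw [h t ht, List.getElem?_eq_getElem (by omega)]
  · refine fun h => ⟨by omega, fun t ht => ?_⟩
    rw [h t ht, List.getElem?_eq_getElem (by omega)]

theorem dropLast_take_drop {s : List ℕ} {p l : ℕ} (hp : p + l ≤ s.length) :
    ((s.drop p).take l).dropLast = (s.drop p).take (l - 1) := by
  rw [List.dropLast_eq_take, List.take_take]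
  congr 1
  simp; omega

theorem exists_occursAt_iff {s : List ℕ} {p l : ℕ} (hp : p + l ≤ s.length) :
    (∃ j, j ≤ p ∧ OccursAt ((s.drop p).take l).dropLast s j) ↔
      ∃ j < p, ∀ t < l - 1, s[j + t]? = s[p + t]? := by
  rw [dropLast_take_drop hp]
  constructor
  · rintro ⟨j, hj, ho⟩
    obtain ⟨j, rfl⟩ : ∃ i, j = i + 1 := ⟨j - 1, by have := ho.1; omega⟩
    exact ⟨j, by omega, (occursAt_iff (by omega)).1 ho⟩
  · rintro ⟨j, hj, ho⟩
    exact ⟨j + 1, by omega, (occursAt_iff (by omega)).2 ho⟩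

theorem isPhrase_take_iff {s : List ℕ} {p l : ℕ} (hp : p + l ≤ s.length) :
    IsPhrase s p ((s.drop p).take l) ↔
      l = 1 ∨ (1 < l ∧ ∃ j < p, ∀ t < l - 1, s[j + t]? = s[p + t]?) := by
  have hl : ((s.drop p).take l).length = l := by simp; omega
  rw [IsPhrase, exists_occursAt_iff hp, hl]
  simp [List.take_prefix]

theorem IsPhrase.exists_match {s f : List ℕ} {p : ℕ} (h : IsPhrase s p f) (hf : 1 < f.length) :
    ∃ j < p, ∀ t < f.length - 1, s[j + t]? = s[p + t]? := by
  have h' := h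
  rw [h.eq_take, isPhrase_take_iff h.add_length_le] at h'
  rcases h' with h' | h'
  · omega
  · exact h'.2

theorem IsGreedyPhrase.le_of_match {s f : List ℕ} {p l j : ℕ} (h : IsGreedyPhrase s p f)
    (hl : 0 < l) (hp : p + l ≤ s.length) (hj : j < p)
    (hm : ∀ t < l - 1, s[j + t]? = s[p + t]?) : l ≤ f.length := by
  have := h.2 ((s.drop p).take l) ((isPhrase_take_iff hp).2 (by
    by_cases h1 : l = 1
    · exact Or.inl h1
    · exact Or.inr ⟨by omega, j, hj, hm⟩))
  have hl : ((s.drop p).take l).length = l := by simp; omega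
  omega

/-! ### Greedy phrases against the phrases of an arbitrary parsing -/

section Parsing
variable {s : List ℕ} {P Q : List (List ℕ)}

theorem IsGreedyParsing.isParsing (h : IsGreedyParsing s P) : IsParsing s P :=
  ⟨h.1, fun i hi => (h.2 i hi).1⟩

theorem IsParsing.start_length (h : IsParsing s P) : start P P.length = s.length := by
  rw [LZ77.start_length, h.1]

theorem IsParsing.start_lt_succ (h : IsParsing s P) {i : ℕ} (hi : i < P.length) :
    start P i < start P (i + 1) := by
  have := (h.2 i hi).length_pos
  rw [start_succ P hi]; omega

theorem IsParsing.start_le (h : IsParsing s P) (i : ℕ) : start P i ≤ s.length := by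
  rcases le_or_gt i P.length with hi | hi
  · rw [← h.start_length]; exact start_mono P hi
  · simp [start, List.take_of_length_le hi.le, h.1]

theorem IsParsing.lt_length_of_start_lt (h : IsParsing s P) {i : ℕ}
    (hi : start P i < s.length) : i < P.length := by
  by_contra hc
  have := start_mono P (not_lt.1 hc)
  rw [h.start_length] at this
  omega

/-- Every position lies in a phrase. -/
theorem IsParsing.exists_phrase_at (h : IsParsing s P) {p : ℕ} (hp : p < s.length) :
    ∃ i < P.length, start P i ≤ p ∧ p < start P (i + 1) := by
  classical
  have hex : ∃ i, p < start P (i + 1) := by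
    have hl := h.start_length
    refine ⟨P.length, ?_⟩
    have := start_mono P (show P.length ≤ P.length + 1 by omega)
    omega
  have hs := Nat.find_spec hex
  have hlow : start P (Nat.find hex) ≤ p := by
    rcases h0 : Nat.find hex with _ | i
    · simp [start_zero]
    · have := Nat.find_min hex (m := i) (by omega)
      omega
  exact ⟨Nat.find hex, h.lt_length_of_start_lt (by omega), hlow, hs⟩

/-- A phrase of a parsing does not extend beyond a greedy phrase that starts in it. -/
theorem IsGreedyParsing.not_covered (hP : IsGreedyParsing s P) (hQ : IsParsing s Q) {i k : ℕ}
    (hi : i < P.length) (hk : k < Q.length) (hle : start Q k ≤ start P i) :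
    start Q (k + 1) ≤ start P (i + 1) := by
  by_contra! hlt
  have hlen := (hP.2 i hi).1.length_pos
  have hPs := start_succ P hi
  have hQs := start_succ Q hk
  obtain ⟨j, hj, hm⟩ := (hQ.2 k hk).exists_match (by omega)
  have hend := hQ.start_le (k + 1)
  -- The source of the longer phrase, shifted to the start of the greedy one, would allow the greedy
  -- phrase one more letter.
  have := (hP.2 i hi).le_of_match (l := P[i].length + 1) (j := j + (start P i - start Q k))
    (by omega) (by omega) (by omega) (fun t ht => by
      have := hm (start P i - start Q k + t) (by omega)
      rwa [← add_assoc, ← add_assoc, Nat.add_sub_cancel' hle] at this)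
  omega

/-- By `not_covered`, no phrase of `Q` contains the starts of two greedy phrases, so sending a
greedy phrase to the phrase of `Q` that contains its start is injective. -/
theorem IsGreedyParsing.length_le (hP : IsGreedyParsing s P) (hQ : IsParsing s Q) :
    P.length ≤ Q.length := by
  have key : ∀ i : Fin P.length, ∃ k : Fin Q.length,
      start Q k ≤ start P i ∧ start P i < start Q (k + 1) := by
    rintro ⟨i, hi⟩
    have h1 := hP.isParsing.start_lt_succ hi
    have h2 := hP.isParsing.start_le (i + 1)
    obtain ⟨k, hk, h⟩ := hQ.exists_phrase_at (p := start P i) (by omega)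
    exact ⟨⟨k, hk⟩, h⟩
  choose f hf using key
  have hmono : StrictMono f := by
    intro i i' hii
    by_contra! hle
    have h1 := hP.not_covered hQ i.2 (f i).2 (hf i).1
    have h2 := start_mono P (show (i : ℕ) + 1 ≤ i' from hii)
    have h3 := start_mono Q (show (f i' : ℕ) + 1 ≤ f i + 1 from Nat.succ_le_succ hle)
    have h4 := (hf i').2
    omega
  simpa using Fintype.card_le_of_injective f hmono.injective

/-- A repeated phrase could be copied whole and extended by a free last letter, contradicting
greediness. The last phrase is excluded because no further letter may be available there. -/
theorem IsGreedyParsing.getElem_inj (hP : IsGreedyParsing s P) {i k : ℕ}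
    (hk : k + 1 < P.length) (hik : i < k) : P[i] ≠ P[k] := by
  intro heq
  have hi1 := (hP.2 i (by omega)).1
  have hk1 := (hP.2 k (by omega)).1
  have hend : start P (k + 1) < s.length := by
    have h1 := hP.isParsing.start_lt_succ hk
    have h2 := hP.isParsing.start_le (k + 1 + 1)
    omega
  have hst : start P i < start P k :=
    (hP.isParsing.start_lt_succ (by omega)).trans_le (start_mono P hik)
  have hPs := start_succ P (show k < P.length by omega)
  have hlen : P[i].length = P[k].length := by rw [heq]
  have := (hP.2 k (by omega)).le_of_match (l := P[k].length + 1) (j := start P i)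
    (by omega) (by omega) hst (fun t ht => by
      have e1 := congrArg (fun l : List ℕ => l[t]?) hi1.eq_take
      have e2 := congrArg (fun l : List ℕ => l[t]?) hk1.eq_take
      simp only [heq] at e1
      rw [e1] at e2
      rw [List.getElem?_take_of_lt (by omega), List.getElem?_take_of_lt (by omega)] at e2
      simpa using e2)
  omega

/-- The `i`th phrase of `P` and the `k`th phrase of `Q` share a position. -/
def Meets (P Q : List (List ℕ)) (i k : ℕ) : Prop :=
  start Q k < start P (i + 1) ∧ start P i < start Q (k + 1)

open Classical in
-- If `i₀` is the first greedy phrase that the phrase of `Q` meets, then `i₀ + 1` starts after that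
-- phrase does. By `not_covered` it also reaches its end, so no later greedy phrase is met.
theorem IsGreedyParsing.card_meets_le (hP : IsGreedyParsing s P) (hQ : IsParsing s Q) {k : ℕ}
    (hk : k < Q.length) :
    ((Finset.range P.length).filter fun i => Meets P Q i k).card ≤ 2 := by
  rcases Finset.eq_empty_or_nonempty ((Finset.range P.length).filter fun i => Meets P Q i k)
    with h | h
  · simp [h]
  · set i₀ := Finset.min' _ h with hi₀
    have hmem := Finset.min'_mem _ h
    rw [← hi₀, Finset.mem_filter, Finset.mem_range] at hmem
    refine (Finset.card_le_card (t := {i₀, i₀ + 1}) fun i hi => ?_).trans Finset.card_le_two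
    have hle : i₀ ≤ i := Finset.min'_le _ _ hi
    rw [Finset.mem_filter, Finset.mem_range] at hi
    by_contra hne
    simp only [Finset.mem_insert, Finset.mem_singleton, not_or] at hne
    have hlt : i₀ + 1 < i := by omega
    have h1 := hP.not_covered hQ (i := i₀ + 1) (by omega) hk hmem.2.1.le
    have h2 := start_mono P (show i₀ + 1 + 1 ≤ i by omega)
    have h3 := hP.isParsing.start_lt_succ (show i₀ + 1 < P.length by omega)
    have h4 := hi.2.2
    have h5 := hP.isParsing.start_lt_succ (show i₀ < P.length by omega)
    omega

theorem one_add_sum_le_prod {ι : Type*} (T : Finset ι) (f : ι → ℕ) :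
    1 + ∑ i ∈ T, f i ≤ ∏ i ∈ T, (f i + 1) := by
  classical
  induction T using Finset.induction_on with
  | empty => simp
  | insert a T ha ih =>
    rw [Finset.sum_insert ha, Finset.prod_insert ha]
    nlinarith [Nat.zero_le (f a), Nat.zero_le (∑ i ∈ T, f i), Nat.zero_le (f a * ∑ i ∈ T, f i)]

open Classical in
-- The phrases of `Q` that meet the phrase cover it, so its length is at most the sum of theirs;
-- `one_add_sum_le_prod` makes the logarithm subadditive.
theorem logb_length_le_sum_meets (hP : IsParsing s P) (hQ : IsParsing s Q) {i : ℕ}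
    (hi : i < P.length) :
    Real.logb 2 (P[i].length + 1) ≤
      ∑ k ∈ (Finset.range Q.length).filter (fun k => Meets P Q i k),
        Real.logb 2 ((start Q (k + 1) - start Q k : ℕ) + 1) := by
  set T := (Finset.range Q.length).filter (fun k => Meets P Q i k) with hT
  have hsum : P[i].length ≤ ∑ k ∈ T, (start Q (k + 1) - start Q k) := by
    have hsub : Finset.Ico (start P i) (start P (i + 1)) ⊆
        T.biUnion fun k => Finset.Ico (start Q k) (start Q (k + 1)) := by
      intro x hx
      rw [Finset.mem_Ico] at hx
      have hend := hP.start_le (i + 1)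
      obtain ⟨k, hk, h1, h2⟩ := hQ.exists_phrase_at (p := x) (by omega)
      simp only [Finset.mem_biUnion, Finset.mem_Ico, hT, Finset.mem_filter, Finset.mem_range]
      exact ⟨k, ⟨hk, by unfold Meets; omega⟩, h1, h2⟩
    have := (Finset.card_le_card hsub).trans Finset.card_biUnion_le
    simp only [Nat.card_Ico] at this
    rw [start_succ P hi] at this
    simpa using this
  rw [← Real.logb_prod _ _ (fun k _ => by positivity)]
  refine Real.logb_le_logb_of_le (by norm_num) (by positivity) ?_
  have := one_add_sum_le_prod T fun k => start Q (k + 1) - start Q k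
  calc ((P[i].length : ℝ) + 1) ≤ ((1 + ∑ k ∈ T, (start Q (k + 1) - start Q k) : ℕ) : ℝ) := by
        push_cast; rw [add_comm]; gcongr; exact_mod_cast hsum
    _ ≤ _ := by
        refine (Nat.cast_le.2 this).trans_eq ?_
        push_cast; rfl

open Classical in
/-- Many long greedy phrases force every parsing to have many bits in its phrase lengths. -/
theorem IsGreedyParsing.card_long_mul_logb_le (hP : IsGreedyParsing s P) (hQ : IsParsing s Q)
    (L : ℕ) :
    ((Finset.range P.length).filter fun i => L < start P (i + 1) - start P i).card *
        Real.logb 2 (L + 1) ≤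
      2 * ∑ k ∈ Finset.range Q.length, Real.logb 2 ((start Q (k + 1) - start Q k : ℕ) + 1) := by
  set w : ℕ → ℝ := fun k => Real.logb 2 ((start Q (k + 1) - start Q k : ℕ) + 1) with hw
  have hw0 : ∀ k, 0 ≤ w k := fun k => Real.logb_nonneg (by norm_num) (by simp)
  have step : ∀ i ∈ (Finset.range P.length).filter fun i => L < start P (i + 1) - start P i,
      Real.logb 2 (L + 1) ≤ ∑ k ∈ (Finset.range Q.length).filter (fun k => Meets P Q i k), w k := by
    intro i hi
    rw [Finset.mem_filter, Finset.mem_range] at hi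
    refine le_trans ?_ (logb_length_le_sum_meets hP.isParsing hQ hi.1)
    refine Real.logb_le_logb_of_le (by norm_num) (by positivity) ?_
    have := hi.2
    rw [start_succ P hi.1] at this
    gcongr
    omega
  calc _ = ∑ i ∈ (Finset.range P.length).filter fun i => L < start P (i + 1) - start P i,
          Real.logb 2 (L + 1) := by simp
    _ ≤ ∑ i ∈ (Finset.range P.length).filter fun i => L < start P (i + 1) - start P i,
          ∑ k ∈ (Finset.range Q.length).filter (fun k => Meets P Q i k), w k :=
        Finset.sum_le_sum step
    _ ≤ ∑ i ∈ Finset.range P.length,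
          ∑ k ∈ (Finset.range Q.length).filter (fun k => Meets P Q i k), w k :=
        Finset.sum_le_sum_of_subset_of_nonneg (Finset.filter_subset _ _)
          fun i _ _ => Finset.sum_nonneg fun k _ => hw0 k
    -- Double counting of the meeting pairs: each phrase of `Q` is now charged once per greedy
    -- phrase that it meets.
    _ = ∑ k ∈ Finset.range Q.length,
          ∑ i ∈ (Finset.range P.length).filter (fun i => Meets P Q i k), w k := by
        simp only [Finset.sum_filter]; exact Finset.sum_comm
    _ ≤ ∑ k ∈ Finset.range Q.length, 2 * w k := by
        refine Finset.sum_le_sum fun k hk => ?_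
        rw [Finset.sum_const, nsmul_eq_mul]
        have := hP.card_meets_le hQ (Finset.mem_range.1 hk)
        exact mul_le_mul_of_nonneg_right (by exact_mod_cast this) (hw0 k)
    _ = _ := by rw [Finset.mul_sum]

open Classical in
-- Distinct words of length at most `L`, padded by `none`, are distinct functions from `Fin L` to an
-- alphabet with one extra symbol. The additional `1` is for the last phrase, which may repeat an
-- earlier one.
theorem IsGreedyParsing.card_short_le (hP : IsGreedyParsing s P) (L : ℕ) :
    ((Finset.range P.length).filter fun i => ¬ L < start P (i + 1) - start P i).card ≤
      (alphabetSize s + 1) ^ L + 1 := by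
  set S := (Finset.range P.length).filter fun i => ¬ L < start P (i + 1) - start P i with hS
  let W : Finset (Fin L → Option ℕ) :=
    Fintype.piFinset fun _ => insert none (s.toFinset.image some)
  have hW : W.card ≤ (alphabetSize s + 1) ^ L := by
    rw [Fintype.card_piFinset_const]
    refine (Nat.pow_le_pow_left ((Finset.card_insert_le _ _).trans
      (Nat.succ_le_succ Finset.card_image_le)) _).trans_eq ?_
    simp [alphabetSize]
  have hinj : (S.erase (P.length - 1)).card ≤ W.card := by
    refine Finset.card_le_card_of_injOn (fun i (t : Fin L) => (P.getD i [])[(t : ℕ)]?) ?_ ?_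
    · intro i hi
      simp only [hS, Finset.coe_erase, Finset.coe_filter, Finset.mem_range, Set.mem_sdiff,
        Set.mem_ofPred_eq] at hi
      simp only [W, Finset.mem_coe, Fintype.mem_piFinset, Finset.mem_insert, Finset.mem_image,
        List.mem_toFinset]
      intro t
      rcases hc : (P.getD i [])[(t : ℕ)]? with _ | c
      · exact Or.inl rfl
      · refine Or.inr ⟨c, ?_, rfl⟩
        have hm := List.mem_of_getElem? hc
        rw [List.getD_eq_getElem _ _ hi.1.1] at hm
        rw [← hP.1]
        exact List.mem_flatten.2 ⟨_, List.getElem_mem _, hm⟩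
    · have main : ∀ i ∈ S.erase (P.length - 1), ∀ k ∈ S.erase (P.length - 1), i < k →
          (fun t : Fin L => (P.getD i [])[(t : ℕ)]?) ≠ fun t : Fin L => (P.getD k [])[(t : ℕ)]? := by
        intro i hi k hk hik heq
        simp only [hS, Finset.mem_erase, Finset.mem_filter, Finset.mem_range] at hi hk
        refine hP.getElem_inj (i := i) (k := k) (by omega) hik ?_
        rw [start_succ P hi.2.1] at hi
        rw [start_succ P hk.2.1] at hk
        refine List.ext_getElem? fun t => ?_
        rcases lt_or_ge t L with ht | ht
        · have := congrFun heq ⟨t, ht⟩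
          simpa [hi.2.1, hk.2.1] using this
        · rw [List.getElem?_eq_none (by omega), List.getElem?_eq_none (by omega)]
      intro i hi k hk heq
      rcases lt_trichotomy i k with h | h | h
      · exact absurd heq (main i hi k hk h)
      · exact h
      · exact absurd heq.symm (main k hk i hi h)
  have := Finset.pred_card_le_card_erase (s := S) (a := P.length - 1)
  omega

end Parsing

/-! ### Sizes of encodings -/

/-- The code of `0` has an unconstrained but fixed length, which `log y ≥ 1` absorbs; for positive
`x`, `x + 1 ≤ y²`. -/
theorem IsLogEncoder.exists_length_le {e : ℕ → List Bool} (he : IsLogEncoder e) :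
    ∃ K : ℝ, 0 < K ∧ ∀ (x : ℕ) (y : ℝ), 2 ≤ y → (x : ℝ) ≤ y →
      ((e x).length : ℝ) ≤ K * Real.logb 2 y := by
  obtain ⟨a, b, ha, hb, h⟩ := he
  refine ⟨(e 0).length + 2 * b, by positivity, fun x y hy hx => ?_⟩
  have h1 : 1 ≤ Real.logb 2 y := by
    rw [Real.le_logb_iff_rpow_le (by norm_num) (by linarith)]; simpa using hy
  rcases Nat.eq_zero_or_pos x with rfl | hpos
  · have : (0 : ℝ) ≤ (e 0).length := by positivity
    nlinarith
  · have h2 : Real.logb 2 ((x : ℝ) + 1) ≤ 2 * Real.logb 2 y := by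
      rw [two_mul, ← Real.logb_mul (by linarith) (by linarith)]
      refine Real.logb_le_logb_of_le (by norm_num) (by positivity) ?_
      nlinarith
    have h3 : (0 : ℝ) ≤ (e 0).length := by positivity
    have h4 := (h x hpos).2
    nlinarith

/-- The number of bits in the encoding of one phrase. -/
def tripleSize (ed el ec : ℕ → List Bool) (t : Triple) : ℕ :=
  (ed t.d).length + (el t.l).length + (ec t.c).length

theorem encode_length (ed el ec : ℕ → List Bool) (T : List Triple) :
    (encode ed el ec T).length = (T.map (tripleSize ed el ec)).sum := by
  simp only [encode, List.length_flatMap, List.length_append]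
  rfl

theorem sum_map_eq_sum_range {α : Type*} [Inhabited α] (f : α → ℕ) (T : List α) :
    (T.map f).sum = ∑ k ∈ Finset.range T.length, f (T.getD k default) := by
  induction T with
  | nil => simp
  | cons a T ih => simp [Finset.sum_range_succ', ih, add_comm]

instance : Inhabited Triple := ⟨⟨0, 0, 0⟩⟩

theorem encode_length_eq_sum (ed el ec : ℕ → List Bool) (T : List Triple) :
    (encode ed el ec T).length =
      ∑ k ∈ Finset.range T.length, tripleSize ed el ec (T.getD k default) := by
  rw [encode_length, sum_map_eq_sum_range]

section Sizes
variable {ed el ec : ℕ → List Bool} {s : List ℕ}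

theorem exists_LZopt (ed el ec : ℕ → List Bool) (s : List ℕ) : ∃ Q T, IsParsing s Q ∧
    RepresentsAll s Q T ∧ (encode ed el ec T).length = LZopt ed el ec s := by
  have hne : {m | ∃ P, IsParsing s P ∧ m ∈ encodingSizes ed el ec s P}.Nonempty := by
    obtain ⟨m, hm⟩ := encodingSizes_nonempty ed el ec (greedyParsing_isParsing s)
    exact ⟨m, _, greedyParsing_isParsing s, hm⟩
  obtain ⟨Q, hQ, T, hT, h⟩ := Nat.sInf_mem hne
  exact ⟨Q, T, hQ, hT, h⟩

theorem exists_LZgr (ed el ec : ℕ → List Bool) (s : List ℕ) : ∃ T,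
    RepresentsAll s (greedyParsing s) T ∧ (encode ed el ec T).length = LZgr ed el ec s :=
  Nat.sInf_mem (encodingSizes_nonempty ed el ec (greedyParsing_isParsing s))

theorem LZopt_le {Q : List (List ℕ)} {T : List Triple} (hQ : IsParsing s Q)
    (hT : RepresentsAll s Q T) : LZopt ed el ec s ≤ (encode ed el ec T).length :=
  Nat.sInf_le ⟨Q, hQ, T, hT, rfl⟩

theorem RepresentsAll.sum_logb_le {a : ℝ} (ha : ∀ x : ℕ, 1 ≤ x →
      a * Real.logb 2 ((x : ℝ) + 1) ≤ ((el x).length : ℝ))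
    {Q : List (List ℕ)} {T : List Triple} (hQ : IsParsing s Q) (hT : RepresentsAll s Q T) :
    a * ∑ k ∈ Finset.range Q.length, Real.logb 2 ((start Q (k + 1) - start Q k : ℕ) + 1) ≤
      (encode ed el ec T).length := by
  rw [encode_length_eq_sum, hT.1, Finset.mul_sum, Nat.cast_sum]
  refine Finset.sum_le_sum fun k hk => ?_
  rw [Finset.mem_range] at hk
  have hk' : k < T.length := by rw [hT.1]; exact hk
  have hr := hT.2 k hk hk'
  rw [List.getD_eq_getElem _ _ hk', start_succ Q hk, Nat.add_sub_cancel_left, ← hr.1]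
  refine (ha _ (by rw [hr.1]; exact (hQ.2 k hk).length_pos)).trans ?_
  simp only [tripleSize]
  push_cast
  nlinarith [Nat.cast_nonneg (α := ℝ) (ed T[k].d).length,
    Nat.cast_nonneg (α := ℝ) (ec T[k].c).length]

theorem LZopt_pos (hel : IsLogEncoder el) (hs : s ≠ []) : 0 < LZopt ed el ec s := by
  obtain ⟨a, b, ha, hb, h⟩ := hel
  obtain ⟨Q, T, hQ, hT, hL⟩ := exists_LZopt ed el ec s
  have h1 := hT.sum_logb_le (ed := ed) (ec := ec) (fun x hx => (h x hx).1) hQ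
  rw [hL] at h1
  have hlen : 0 < Q.length := by
    rcases Q with _ | ⟨f, Q⟩
    · exact absurd hQ.1.symm (by simpa using hs)
    · simp
  have h2 : 0 < ∑ k ∈ Finset.range Q.length,
      Real.logb 2 ((start Q (k + 1) - start Q k : ℕ) + 1) := by
    refine Finset.sum_pos (fun k hk => ?_) (by simpa using hlen.ne')
    have := hQ.start_lt_succ (Finset.mem_range.1 hk)
    refine Real.logb_pos (by norm_num) ?_
    have : 0 < start Q (k + 1) - start Q k := by omega
    have : (0 : ℝ) < (start Q (k + 1) - start Q k : ℕ) := by exact_mod_cast this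
    linarith
  have : (0 : ℝ) < LZopt ed el ec s := (mul_pos ha h2).trans_le h1
  exact_mod_cast this

theorem Represents.bounds {p : ℕ} {f : List ℕ} {t : Triple} (hf : IsPhrase s p f)
    (ht : Represents s p f t) : t.d ≤ s.length ∧ t.l ≤ s.length ∧ t.c ∈ s := by
  have h1 := hf.add_length_le
  refine ⟨?_, by rw [ht.1]; omega, ?_⟩
  · rcases ht.2.2 with h | ⟨_, j, _, _, h⟩ <;> omega
  · have := List.mem_of_mem_getLast? ht.2.1
    exact List.mem_of_mem_drop (hf.1.subset this)

theorem exists_LZgr_le (hed : IsLogEncoder ed) (hel : IsLogEncoder el) (hec : IsLogEncoder ec) :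
    ∃ K : ℝ, 0 < K ∧ ∀ (n : ℕ) (s : List ℕ), 2 ≤ n → s.length = n → (∀ x ∈ s, x ≤ n) →
      (LZgr ed el ec s : ℝ) ≤ K * (greedyCount s * Real.logb 2 n) := by
  obtain ⟨K₁, h₁, hK₁⟩ := hed.exists_length_le
  obtain ⟨K₂, h₂, hK₂⟩ := hel.exists_length_le
  obtain ⟨K₃, h₃, hK₃⟩ := hec.exists_length_le
  refine ⟨K₁ + K₂ + K₃, by positivity, fun n s hn hs hx => ?_⟩
  have hn' : (2 : ℝ) ≤ n := by exact_mod_cast hn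
  obtain ⟨T, hT, hL⟩ := exists_LZgr ed el ec s
  rw [← hL, encode_length_eq_sum, hT.1, Nat.cast_sum]
  refine (Finset.sum_le_card_nsmul _ _ ((K₁ + K₂ + K₃) * Real.logb 2 n) fun k hk => ?_).trans_eq ?_
  · rw [Finset.mem_range] at hk
    have hk' : k < T.length := by rw [hT.1]; exact hk
    obtain ⟨b1, b2, b3⟩ := (hT.2 k hk hk').bounds ((greedyParsing_isParsing s).2 k hk)
    rw [List.getD_eq_getElem _ _ hk', tripleSize]
    rw [hs] at b1 b2
    push_cast
    have := hK₁ _ n hn' (by exact_mod_cast b1)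
    have := hK₂ _ n hn' (by exact_mod_cast b2)
    have := hK₃ _ n hn' (by exact_mod_cast hx _ b3)
    linarith
  · rw [Finset.card_range, nsmul_eq_mul, greedyCount]; ring

/-- Under `hL` at least half of the greedy phrases are longer than `L`. The factor `4` combines this
half with the at most two greedy phrases met by each phrase. -/
theorem mul_greedyCount_le_LZopt {a : ℝ} (ha0 : 0 < a) (ha : ∀ x : ℕ, 1 ≤ x →
      a * Real.logb 2 ((x : ℝ) + 1) ≤ ((el x).length : ℝ)) (L : ℕ)
    (hL : 2 * ((alphabetSize s + 1) ^ L + 1) ≤ greedyCount s) :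
    a * (greedyCount s * Real.logb 2 (L + 1)) ≤ 4 * LZopt ed el ec s := by
  classical
  obtain ⟨Q, T, hQ, hT, hsize⟩ := exists_LZopt ed el ec s
  have h1 := hT.sum_logb_le (ed := ed) (ec := ec) ha hQ
  have h2 := (greedyParsing_spec s).card_long_mul_logb_le hQ L
  have h3 := (greedyParsing_spec s).card_short_le L
  have h4 := Finset.card_filter_add_card_filter_not (s := Finset.range (greedyParsing s).length)
    (fun i => L < start (greedyParsing s) (i + 1) - start (greedyParsing s) i)
  rw [Finset.card_range] at h4
  set c := ((Finset.range (greedyParsing s).length).filter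
    fun i => L < start (greedyParsing s) (i + 1) - start (greedyParsing s) i).card
  have h5 : greedyCount s ≤ 2 * c := by unfold greedyCount at hL ⊢; omega
  have h5' : (greedyCount s : ℝ) ≤ 2 * c := by exact_mod_cast h5
  have h6 : 0 ≤ Real.logb 2 ((L : ℝ) + 1) := Real.logb_nonneg (by norm_num) (by simp)
  rw [hsize] at h1
  have h7 := mul_le_mul_of_nonneg_right h5' h6
  nlinarith

end Sizes

/-! ### The upper bound -/

theorem eventually_add_mul_logb_le_rpow (A B : ℝ) {r : ℝ} (hr : 0 < r) :
    ∀ᶠ x : ℝ in atTop, A + B * Real.logb 2 x ≤ x ^ r := by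
  have h1 : (fun x : ℝ => A + B * Real.logb 2 x) =o[atTop] fun x : ℝ => x ^ r := by
    refine IsLittleO.add ?_ (IsLittleO.const_mul_left ?_ _)
    · exact isLittleO_const_left.2 (Or.inr (tendsto_norm_atTop_atTop.comp (tendsto_rpow_atTop hr)))
    · have := (isLittleO_log_rpow_atTop hr).const_mul_left (Real.log 2)⁻¹
      exact this.congr_left fun x => by rw [Real.logb, div_eq_inv_mul]
  filter_upwards [h1.def zero_lt_one, eventually_ge_atTop 0] with x hx h0
  rw [one_mul, Real.norm_of_nonneg (Real.rpow_nonneg h0 r)] at hx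
  exact (le_abs_self _).trans hx

theorem tendsto_logb_natCast_atTop : Tendsto (fun n : ℕ => Real.logb 2 n) atTop atTop :=
  (Real.tendsto_logb_atTop (by norm_num)).comp tendsto_natCast_atTop_atTop

/-- With `y = x^(ε/2)`, the left side is at most `2^(2 + (1 + C log x) y)`. Its exponent is at most
`(3 + C log x) y ≤ y² = x^ε`. -/
theorem two_mul_pow_floor_add_one_le {ε C x : ℝ} (hC : 0 < C) (hε : 0 < ε) (hx : 1 ≤ x)
    (h : 3 + C * Real.logb 2 x ≤ x ^ (ε / 2)) {k : ℕ} (hk : (k : ℝ) ≤ x ^ C) :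
    (2 * ((k + 1) ^ ⌊x ^ (ε / 2)⌋₊ + 1) : ℝ) ≤ 2 ^ (x ^ ε) := by
  have hx0 : 0 < x := by linarith
  set y := x ^ (ε / 2) with hy
  have hy1 : 1 ≤ y := Real.one_le_rpow hx (by positivity)
  have hxC : 1 ≤ x ^ C := Real.one_le_rpow hx hC.le
  have hsq : x ^ ε = y * y := by rw [hy, ← Real.rpow_add hx0]; ring_nf
  have h1 : ((k : ℝ) + 1) ≤ 2 ^ (1 + C * Real.logb 2 x) := by
    rw [Real.rpow_add (by norm_num), mul_comm C, Real.rpow_mul (by norm_num),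
      Real.rpow_logb (by norm_num) (by norm_num) hx0, Real.rpow_one]
    linarith
  have h2 : ((k : ℝ) + 1) ^ ⌊y⌋₊ ≤ 2 ^ ((1 + C * Real.logb 2 x) * y) := by
    rw [Real.rpow_mul (by norm_num), ← Real.rpow_natCast]
    calc ((k : ℝ) + 1) ^ (⌊y⌋₊ : ℝ) ≤ (k + 1) ^ y :=
          Real.rpow_le_rpow_of_exponent_le (by simp) (Nat.floor_le (by linarith))
      _ ≤ _ := Real.rpow_le_rpow (by positivity) h1 (by linarith)
  have h3 : (1 : ℝ) ≤ 2 ^ ((1 + C * Real.logb 2 x) * y) := by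
    refine le_trans ?_ h2
    exact one_le_pow₀ (by simp)
  calc (2 * ((k + 1) ^ ⌊y⌋₊ + 1) : ℝ) ≤ 2 ^ (2 : ℝ) * 2 ^ ((1 + C * Real.logb 2 x) * y) := by
        norm_num; linarith
    _ = 2 ^ (2 + (1 + C * Real.logb 2 x) * y) := by rw [Real.rpow_add (by norm_num)]
    _ ≤ _ := by
        refine Real.rpow_le_rpow_of_exponent_le (by norm_num) ?_
        rw [hsq]; nlinarith

theorem one_lt_logb_two_natCast {n : ℕ} (hn : 3 ≤ n) : 1 < Real.logb 2 n := by
  rw [Real.lt_logb_iff_rpow_lt (by norm_num) (by positivity)]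
  have : (3 : ℝ) ≤ n := by exact_mod_cast hn
  norm_num; linarith

theorem greedyCount_le_length (s : List ℕ) : greedyCount s ≤ s.length := by
  have h := greedyParsing_isParsing s
  have key : ∀ i ≤ (greedyParsing s).length, i ≤ start (greedyParsing s) i := by
    intro i hi
    induction i with
    | zero => simp
    | succ i ih =>
      have := h.start_lt_succ hi
      have := ih (by omega)
      omega
  exact (key _ le_rfl).trans_eq h.start_length

theorem greedy_upper_bound {ed el ec : ℕ → List Bool} (hed : IsLogEncoder ed)
    (hel : IsLogEncoder el) (hec : IsLogEncoder ec) {ε C : ℝ} (hε₀ : 0 < ε) (hC : 0 < C) :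
    ∃ K : ℝ, 0 < K ∧ ∀ (n : ℕ) (s : List ℕ), 3 ≤ n → s.length = n → (∀ x ∈ s, x ≤ n) →
      (alphabetSize s : ℝ) ≤ Real.logb 2 n ^ C →
      (2 : ℝ) ^ (Real.logb 2 n ^ ε) ≤ (greedyCount s : ℝ) →
      0 < LZopt ed el ec s ∧
      (LZgr ed el ec s : ℝ) / (LZopt ed el ec s : ℝ) ≤
        K * (Real.logb 2 n / Real.logb 2 (Real.logb 2 n)) := by
  obtain ⟨K₀, hK₀, hgr⟩ := exists_LZgr_le hed hel hec
  obtain ⟨a, b, ha, hb, hab⟩ := id hel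
  obtain ⟨N, hN⟩ := eventually_atTop.1
    (tendsto_logb_natCast_atTop.eventually
      (eventually_add_mul_logb_le_rpow 3 C (half_pos hε₀)))
  -- The first summand serves `n ≥ N`. The second serves the finitely many smaller lengths, where
  -- `LZopt ≥ 1` suffices.
  refine ⟨8 * K₀ / (a * ε) + K₀ * N * N, by positivity, fun n s hn hs hx hσ hz => ?_⟩
  have hpos : 0 < LZopt ed el ec s := LZopt_pos hel (by rintro rfl; simp at hs; omega)
  refine ⟨hpos, ?_⟩
  have hpos' : (0 : ℝ) < LZopt ed el ec s := by exact_mod_cast hpos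
  have hx1 := one_lt_logb_two_natCast hn
  have hup := hgr n s (by omega) hs hx
  set x := Real.logb 2 n with hxdef
  have hll : 0 < Real.logb 2 x := Real.logb_pos (by norm_num) hx1
  rw [div_le_iff₀ hpos']
  have hq : 0 < x / Real.logb 2 x := by positivity
  rcases le_or_gt N n with hNn | hNn
  · have hlow := mul_greedyCount_le_LZopt (ed := ed) (ec := ec) (s := s) ha
      (fun x hx => (hab x hx).1) ⌊x ^ (ε / 2)⌋₊ (by
        have := (two_mul_pow_floor_add_one_le hC hε₀ hx1.le (hN n hNn) hσ).trans hz
        exact_mod_cast this)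
    have hlog : ε / 2 * Real.logb 2 x ≤ Real.logb 2 (⌊x ^ (ε / 2)⌋₊ + 1) := by
      rw [← Real.logb_rpow_eq_mul_logb_of_pos (by linarith)]
      exact Real.logb_le_logb_of_le (by norm_num) (by positivity) (Nat.lt_floor_add_one _).le
    have hlow2 : a * (greedyCount s * (ε / 2 * Real.logb 2 x)) ≤ 4 * LZopt ed el ec s := by
      refine le_trans ?_ hlow
      gcongr
    have : K₀ * (greedyCount s * x) ≤
        8 * K₀ / (a * ε) * (x / Real.logb 2 x) * LZopt ed el ec s := by
      have e : K₀ * (greedyCount s * x) = 2 * K₀ / (a * ε) * (x / Real.logb 2 x) *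
          (a * (greedyCount s * (ε / 2 * Real.logb 2 x))) := by
        field_simp
      rw [e]
      calc _ ≤ 2 * K₀ / (a * ε) * (x / Real.logb 2 x) * (4 * LZopt ed el ec s) := by gcongr
        _ = _ := by ring
    have h0 : 0 ≤ K₀ * N * N * (x / Real.logb 2 x) * LZopt ed el ec s := by positivity
    nlinarith
  · have h1 : (1 : ℝ) ≤ LZopt ed el ec s := by exact_mod_cast hpos
    have h2 : (greedyCount s : ℝ) ≤ N := by
      exact_mod_cast ((greedyCount_le_length s).trans (by omega))
    have hxN : Real.logb 2 x ≤ N := by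
      have e1 : x ≤ n := by
        rw [hxdef, Real.logb_le_iff_le_rpow (by norm_num) (by positivity), Real.rpow_natCast]
        exact_mod_cast (Nat.lt_two_pow_self).le
      have e2 : Real.logb 2 x ≤ x := by
        rw [Real.logb_le_iff_le_rpow (by norm_num) (by linarith)]
        have := one_add_mul_self_le_rpow_one_add (s := 1) (by norm_num) hx1.le
        norm_num at this; linarith
      have e3 : (n : ℝ) ≤ N := by exact_mod_cast hNn.le
      linarith
    have h3 : x ≤ N * (x / Real.logb 2 x) := by
      rw [mul_div_assoc', le_div_iff₀ hll]
      nlinarith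
    have h4 : K₀ * (greedyCount s * x) ≤ K₀ * N * N * (x / Real.logb 2 x) := by
      calc K₀ * (greedyCount s * x) ≤ K₀ * (N * (N * (x / Real.logb 2 x))) := by gcongr
        _ = _ := by ring
    have h5 : 0 ≤ 8 * K₀ / (a * ε) * (x / Real.logb 2 x) * LZopt ed el ec s := by positivity
    have h6 : K₀ * N * N * (x / Real.logb 2 x) ≤
        K₀ * N * N * (x / Real.logb 2 x) * LZopt ed el ec s :=
      le_mul_of_one_le_right (by positivity) h1
    nlinarith

/-! ### Blocks coding the digits of a counter -/

/-- The letter at offset `o` of the block that codes the number `i` by its `q` lowest digits in base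
`σ`: every digit is preceded by `1`, the last one is also followed by `1`, and then come zeros. -/
def blockLetter (σ q i o : ℕ) : ℕ :=
  if 2 * q < o then 0 else if o % 2 = 0 then 1 else i / σ ^ (o / 2) % σ

section Block
variable {σ q i k o : ℕ}

theorem blockLetter_of_lt (h : 2 * q < o) : blockLetter σ q i o = 0 := if_pos h

theorem blockLetter_even (h : o ≤ 2 * q) (ho : o % 2 = 0) : blockLetter σ q i o = 1 := by
  simp [blockLetter, ho, h]

theorem blockLetter_odd (h : o ≤ 2 * q) (ho : o % 2 = 1) :
    blockLetter σ q i o = i / σ ^ (o / 2) % σ := by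
  simp [blockLetter, ho, h]

theorem blockLetter_lt (hσ : 2 ≤ σ) : blockLetter σ q i o < σ := by
  unfold blockLetter
  split_ifs
  · omega
  · omega
  · exact Nat.mod_lt _ (by omega)

/-- The interleaved ones rule out two adjacent zeros inside a code, so the zeros after it act as a
separator. -/
theorem blockLetter_eq_one_or (h : o ≤ 2 * q) :
    blockLetter σ q i o = 1 ∨ blockLetter σ q i (o + 1) = 1 := by
  rcases Nat.mod_two_eq_zero_or_one o with ho | ho
  · exact Or.inl (blockLetter_even h ho)
  · exact Or.inr (blockLetter_even (by omega) (by omega))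

theorem eq_of_digits_eq (q : ℕ) : ∀ i k : ℕ, i < σ ^ q → k < σ ^ q →
    (∀ t < q, i / σ ^ t % σ = k / σ ^ t % σ) → i = k := by
  induction q with
  | zero => intro i k hi hk _; simp at hi hk; omega
  | succ q ih =>
    intro i k hi hk h
    have h0 := h 0 (by omega)
    simp only [pow_zero, Nat.div_one] at h0
    have h1 := ih (i / σ) (k / σ) (Nat.div_lt_of_lt_mul (by rwa [← pow_succ']))
      (Nat.div_lt_of_lt_mul (by rwa [← pow_succ'])) (fun t ht => by
        have := h (t + 1) (by omega)
        rwa [pow_succ', ← Nat.div_div_eq_div_mul, ← Nat.div_div_eq_div_mul] at this)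
    rw [← Nat.div_add_mod i σ, ← Nat.div_add_mod k σ, h0, h1]

theorem eq_of_blockLetter_eq (hi : i < σ ^ q) (hk : k < σ ^ q)
    (h : ∀ o ≤ 2 * q, blockLetter σ q i o = blockLetter σ q k o) : i = k := by
  refine eq_of_digits_eq q i k hi hk fun t ht => ?_
  have := h (2 * t + 1) (by omega)
  rw [blockLetter_odd (by omega) (by omega), blockLetter_odd (by omega) (by omega)] at this
  simpa [show (2 * t + 1) / 2 = t by omega] using this

/-- Passing from `i` to `i + 1` turns the lowest digits into zeros, changes one more digit and keeps
the others. -/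
theorem exists_carry (hσ : 2 ≤ σ) (hi : i + 1 < σ ^ q) : ∃ t < q,
    (∀ k < t, (i + 1) / σ ^ k % σ = 0) ∧
    ∀ k, t < k → (i + 1) / σ ^ k = i / σ ^ k := by
  classical
  have hex : ∃ t, ¬ σ ^ (t + 1) ∣ i + 1 := by
    refine ⟨q, fun h => ?_⟩
    have h1 := Nat.le_of_dvd (by omega) h
    have h2 : σ ^ q ≤ σ ^ (q + 1) := Nat.pow_le_pow_right (by omega) (by omega)
    omega
  -- The carry stops at the exponent of the largest power of `σ` dividing `i + 1`; a quotient
  -- changes only when its divisor divides `i + 1`.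
  refine ⟨Nat.find hex, ?_, fun k hk => ?_, fun k hk => ?_⟩
  · rcases Nat.eq_zero_or_pos q with rfl | hq
    · simp at hi
    · refine lt_of_le_of_lt (Nat.find_min' hex (m := q - 1) fun h => ?_) (by omega)
      rw [Nat.sub_add_cancel hq] at h
      have h1 := Nat.le_of_dvd (by omega) h
      omega
  · obtain ⟨c, hc⟩ := not_not.1 (Nat.find_min hex hk)
    rw [hc, pow_succ, mul_assoc, Nat.mul_div_cancel_left _ (by positivity)]
    simp
  · rw [Nat.succ_div, if_neg, add_zero]
    intro h
    exact Nat.find_spec hex ((pow_dvd_pow σ hk).trans h)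

end Block

/-! ### The hard string and its repeated substrings -/

/-- The letter at position `p` of the string: the blocks of `0, …, m`, each with two zeros at its
end, then `R` zeros and a `1`, then the blocks of `0, …, m - 1`, each with three zeros at its end,
and finally the letters `0, 1, 2, …`. -/
def letter (σ q m R p : ℕ) : ℕ :=
  if p < (m + 1) * (2 * q + 3) then blockLetter σ q (p / (2 * q + 3)) (p % (2 * q + 3))
  else if p < (m + 1) * (2 * q + 3) + R then 0
  else if p < (m + 1) * (2 * q + 3) + R + 1 then 1
  else if p < (m + 1) * (2 * q + 3) + R + 1 + m * (2 * q + 4) then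
    blockLetter σ q ((p - ((m + 1) * (2 * q + 3) + R + 1)) / (2 * q + 4))
      ((p - ((m + 1) * (2 * q + 3) + R + 1)) % (2 * q + 4))
  else p - ((m + 1) * (2 * q + 3) + R + 1 + m * (2 * q + 4))

section Letter
variable {σ q m R i k o p j : ℕ}

theorem block_end_le {H : ℕ} (hi : i < m) (ho : o < H) : i * H + o < m * H := by
  calc i * H + o < i * H + H := by omega
    _ = (i + 1) * H := by ring
    _ ≤ m * H := Nat.mul_le_mul_right _ hi

theorem exists_block {H : ℕ} (hp : p < m * H) : ∃ i < m, ∃ o < H, p = i * H + o := by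
  have hH : 0 < H := by rcases Nat.eq_zero_or_pos H with rfl | h <;> simp_all
  exact ⟨p / H, Nat.div_lt_of_lt_mul (by rwa [mul_comm]), p % H, Nat.mod_lt _ hH,
    (Nat.div_add_mod' p H).symm⟩

theorem letter_first (hi : i ≤ m) (ho : o < 2 * q + 3) :
    letter σ q m R (i * (2 * q + 3) + o) = blockLetter σ q i o := by
  rw [letter, if_pos (block_end_le (by omega) ho), Nat.add_comm (i * _) o,
    Nat.add_mul_div_right _ _ (by omega), Nat.div_eq_of_lt ho, Nat.add_mul_mod_self_right,
    Nat.mod_eq_of_lt ho, zero_add]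

theorem letter_zero (h1 : (m + 1) * (2 * q + 3) ≤ p) (h2 : p < (m + 1) * (2 * q + 3) + R) :
    letter σ q m R p = 0 := by
  rw [letter, if_neg (by omega), if_pos h2]

theorem letter_one : letter σ q m R ((m + 1) * (2 * q + 3) + R) = 1 := by
  rw [letter, if_neg (by omega), if_neg (by omega), if_pos (by omega)]

theorem letter_second (hi : i < m) (ho : o < 2 * q + 4) :
    letter σ q m R ((m + 1) * (2 * q + 3) + R + 1 + (i * (2 * q + 4) + o)) =
      blockLetter σ q i o := by
  have := block_end_le hi ho
  rw [letter, if_neg (by omega), if_neg (by omega), if_neg (by omega), if_pos (by omega),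
    Nat.add_sub_cancel_left, Nat.add_comm (i * _) o, Nat.add_mul_div_right _ _ (by omega),
    Nat.div_eq_of_lt ho, Nat.add_mul_mod_self_right, Nat.mod_eq_of_lt ho, zero_add]

theorem letter_tail (o : ℕ) :
    letter σ q m R ((m + 1) * (2 * q + 3) + R + 1 + m * (2 * q + 4) + o) = o := by
  rw [letter, if_neg (by omega), if_neg (by omega), if_neg (by omega), if_neg (by omega)]
  omega

theorem letter_lt (hσ : 2 ≤ σ)
    (hp : p < (m + 1) * (2 * q + 3) + R + 1 + m * (2 * q + 4) + σ) : letter σ q m R p < σ := by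
  unfold letter
  split_ifs
  · exact blockLetter_lt hσ
  · omega
  · omega
  · exact blockLetter_lt hσ
  · omega

/-- The code of `k` followed by two zeros does not begin strictly inside a block. -/
theorem offset_eq_zero_of_match {H : ℕ} (hH : 2 * q + 3 ≤ H) (ho : o < H) {g : ℕ → ℕ}
    (hg : ∀ t, o + t < H → g t = blockLetter σ q i (o + t))
    (hm : ∀ t < 2 * q + 3, g t = blockLetter σ q k t) : o = 0 := by
  by_contra h0
  -- If the match starts inside the code of `i`, the two separating zeros fall on adjacent letters
  -- of the code of `k`, one of which is `1`. If it starts in the zeros, it misses the leading `1`.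
  rcases le_or_gt o (2 * q) with h | h
  · have e1 := hg (2 * q + 1 - o) (by omega)
    have e2 := hg (2 * q + 1 - o + 1) (by omega)
    rw [hm _ (by omega), blockLetter_of_lt (σ := σ) (i := i) (by omega)] at e1 e2
    rcases blockLetter_eq_one_or (σ := σ) (i := k) (show 2 * q + 1 - o ≤ 2 * q by omega)
      with h | h <;> omega
  · have e1 := hg 0 (by omega)
    rw [hm _ (by omega), blockLetter_of_lt (σ := σ) (i := i) (by omega),
      blockLetter_even (by omega) rfl] at e1
    omega

/-- Before its place in the second series, the block of `k` occurs only in the first series. -/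
theorem match_block (hq : 1 ≤ q) (hm : m < σ ^ q) (hk : k < m)
    (hj : j < (m + 1) * (2 * q + 3) + R + 1 + k * (2 * q + 4))
    (h : ∀ t < 2 * q + 3, letter σ q m R (j + t) = blockLetter σ q k t) :
    j = k * (2 * q + 3) := by
  have hB : j < (m + 1) * (2 * q + 3) + R + 1 + m * (2 * q + 4) := by
    have := block_end_le (o := 0) (H := 2 * q + 4) hk (by omega)
    omega
  have h0 := h 0 (by omega)
  rw [blockLetter_even (by omega) rfl, add_zero] at h0
  rcases lt_or_ge j ((m + 1) * (2 * q + 3)) with hA | hA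
  · obtain ⟨i, hi, o, ho, rfl⟩ := exists_block hA
    have := offset_eq_zero_of_match (H := 2 * q + 3) le_rfl ho
      (g := fun t => letter σ q m R (i * (2 * q + 3) + o + t)) (i := i)
      (fun t ht => by simp only [add_assoc]; exact letter_first (by omega) ht) h
    subst this
    have := eq_of_blockLetter_eq (σ := σ) (i := i) (k := k) (q := q) (by omega) (by omega) fun o ho => by
      rw [← h o (by omega), add_zero, letter_first (by omega) (by omega)]
    rw [this, add_zero]
  · exfalso
    rcases lt_or_ge j ((m + 1) * (2 * q + 3) + R) with hZ | hZ
    · rw [letter_zero hA hZ] at h0; omega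
    rcases Nat.eq_or_lt_of_le hZ with hZ | hZ
    · have h2 := h 2 (by omega)
      have := letter_second (σ := σ) (q := q) (R := R) (i := 0) (o := 1) (m := m)
        (by omega) (by omega)
      rw [blockLetter_odd (by omega) rfl] at this
      rw [blockLetter_even (by omega) rfl, ← hZ, show (m + 1) * (2 * q + 3) + R + 2 =
        (m + 1) * (2 * q + 3) + R + 1 + (0 * (2 * q + 4) + 1) by ring, this] at h2
      simp at h2
    · obtain ⟨j', rfl⟩ := Nat.exists_eq_add_of_le (show (m + 1) * (2 * q + 3) + R + 1 ≤ j by omega)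
      obtain ⟨i, hi, o, ho, rfl⟩ := exists_block (p := j') (m := k) (H := 2 * q + 4) (by omega)
      have := offset_eq_zero_of_match (H := 2 * q + 4) (by omega) ho
        (g := fun t => letter σ q m R
          ((m + 1) * (2 * q + 3) + R + 1 + (i * (2 * q + 4) + o) + t)) (i := i)
        (fun t ht => by
          simp only [add_assoc _ _ t]; exact letter_second (by omega) ht) h
      subst this
      have := eq_of_blockLetter_eq (σ := σ) (i := i) (k := k) (q := q) (by omega) (by omega)
        fun o ho => by
          rw [← h o (by omega), add_zero, add_assoc ((m + 1) * (2 * q + 3) + R + 1),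
            letter_second (by omega) (by omega)]
      omega

/-- Three zeros in a row do not occur before the end of the first series. -/
theorem not_three_zeros (hj : j + 2 < (m + 1) * (2 * q + 3))
    (h : ∀ t < 3, letter σ q m R (j + t) = 0) : False := by
  obtain ⟨i, hi, o, ho, rfl⟩ := exists_block (show j < (m + 1) * (2 * q + 3) by omega)
  rcases le_or_gt o (2 * q) with hoq | hoq
  · have h0 := h 0 (by omega)
    have h1 := h 1 (by omega)
    rw [add_assoc, letter_first (by omega) (by omega)] at h0 h1
    rcases blockLetter_eq_one_or (σ := σ) (i := i) hoq with h | h <;> simp_all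
  · have hi' : i + 1 ≤ m := by
      by_contra hc
      have : i = m := by omega
      subst this
      have : (i + 1) * (2 * q + 3) = i * (2 * q + 3) + (2 * q + 3) := by ring
      omega
    have h1 := h (2 * q + 3 - o) (by omega)
    rw [show i * (2 * q + 3) + o + (2 * q + 3 - o) = (i + 1) * (2 * q + 3) + 0 by
      rw [add_mul, one_mul]; omega, letter_first hi' (by omega),
      blockLetter_even (by omega) rfl] at h1
    omega

end Letter

/-- The string with the letters `letter σ q m R p`. -/
def hardString (σ q m R : ℕ) : List ℕ :=
  (List.range ((m + 1) * (2 * q + 3) + R + 1 + m * (2 * q + 4) + σ)).map (letter σ q m R)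

/-! ### The greedy parsing of the hard string -/

section Greedy
variable {σ q m R : ℕ}

theorem length_hardString : (hardString σ q m R).length =
    (m + 1) * (2 * q + 3) + R + 1 + m * (2 * q + 4) + σ := by simp [hardString]

theorem getElem?_hardString {p : ℕ} (hp : p < (hardString σ q m R).length) :
    (hardString σ q m R)[p]? = some (letter σ q m R p) := by
  rw [length_hardString] at hp
  simp [hardString, hp]

theorem mem_hardString (hσ : 2 ≤ σ) {x : ℕ} : x ∈ hardString σ q m R ↔ x < σ := by
  simp only [hardString, List.mem_map, List.mem_range]
  constructor
  · rintro ⟨p, hp, rfl⟩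
    exact letter_lt hσ hp
  · exact fun hx => ⟨_, Nat.add_lt_add_left hx _, letter_tail x⟩

theorem alphabetSize_hardString (hσ : 2 ≤ σ) : alphabetSize (hardString σ q m R) = σ := by
  have : (hardString σ q m R).toFinset = Finset.range σ := by
    ext x; simp [mem_hardString hσ]
  rw [alphabetSize, this, Finset.card_range]

theorem getElem?_hardString_eq_iff {p j : ℕ} (hp : p < (hardString σ q m R).length)
    (hj : j < (hardString σ q m R).length) :
    (hardString σ q m R)[j]? = (hardString σ q m R)[p]? ↔
      letter σ q m R j = letter σ q m R p := by
  rw [getElem?_hardString hp, getElem?_hardString hj, Option.some_inj]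

theorem IsPhrase.exists_letter_match {p : ℕ} {f : List ℕ} (h : IsPhrase (hardString σ q m R) p f)
    (hf : 1 < f.length) :
    ∃ j < p, ∀ t < f.length - 1, letter σ q m R (j + t) = letter σ q m R (p + t) := by
  obtain ⟨j, hj, hm⟩ := h.exists_match hf
  have := h.add_length_le
  exact ⟨j, hj, fun t ht => (getElem?_hardString_eq_iff (by omega) (by omega)).1 (hm t ht)⟩

theorem IsGreedyPhrase.le_of_letter_match {p l j : ℕ} {f : List ℕ}
    (h : IsGreedyPhrase (hardString σ q m R) p f) (hl : 0 < l)
    (hp : p + l ≤ (hardString σ q m R).length) (hj : j < p)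
    (hm : ∀ t < l - 1, letter σ q m R (j + t) = letter σ q m R (p + t)) : l ≤ f.length :=
  h.le_of_match hl hp hj fun t ht =>
    (getElem?_hardString_eq_iff (by omega) (by omega)).2 (hm t ht)

theorem letter_zero_of_le {p : ℕ} (h1 : (m + 1) * (2 * q + 3) ≤ p + 2)
    (h2 : p < (m + 1) * (2 * q + 3) + R) : letter σ q m R p = 0 := by
  rcases lt_or_ge p ((m + 1) * (2 * q + 3)) with h | h
  · have e : (m + 1) * (2 * q + 3) = m * (2 * q + 3) + (2 * q + 3) := by ring
    obtain ⟨o, rfl⟩ := Nat.exists_eq_add_of_le (show m * (2 * q + 3) ≤ p by omega)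
    rw [letter_first le_rfl (by omega), blockLetter_of_lt (by omega)]
  · exact letter_zero h h2

variable {P : List (List ℕ)}

/-- A greedy phrase ends right before the second series of blocks. -/
theorem exists_start_eq_second (hR : 4 ≤ R) (hP : IsGreedyParsing (hardString σ q m R) P) :
    ∃ i, start P i = (m + 1) * (2 * q + 3) + R + 1 := by
  have hlen := length_hardString (σ := σ) (q := q) (m := m) (R := R)
  set Z := (m + 1) * (2 * q + 3) with hZ
  have hZ3 : 3 ≤ Z := by rw [hZ]; nlinarith
  obtain ⟨i, hi, h1, h2⟩ := hP.isParsing.exists_phrase_at (p := Z - 2) (by omega)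
  have hs := start_succ P hi
  -- The first series ends with two zeros, at `Z - 2` and `Z - 1`. A phrase going further would copy
  -- three zeros from inside the first series.
  have h3 : start P (i + 1) ≤ Z + 1 := by
    by_contra! hc
    obtain ⟨j, hj, hm⟩ := (hP.2 i hi).1.exists_letter_match (by omega)
    refine not_three_zeros (σ := σ) (q := q) (m := m) (R := R)
      (j := j + (Z - 2 - start P i)) (by omega) fun t ht => ?_
    rw [add_assoc, hm _ (by omega)]
    exact letter_zero_of_le (by omega) (by omega)
  have hi' : i + 1 < P.length := hP.isParsing.lt_length_of_start_lt (by omega)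
  have hs' := start_succ P hi'
  have hone : letter σ q m R (Z + R) = 1 := letter_one
  -- The rest of the zero run is copied from distance `1`, with the isolated `1` as the free last
  -- letter.
  have hge := (hP.2 _ hi').le_of_letter_match (l := Z + R + 1 - start P (i + 1))
    (j := start P (i + 1) - 1) (by omega) (by omega) (by omega) fun t ht => by
      rw [letter_zero_of_le (by omega) (by omega), letter_zero_of_le (by omega) (by omega)]
  refine ⟨i + 1 + 1, ?_⟩
  rw [hs']
  -- A longer phrase would need an earlier copy of the remaining zeros followed by `1`. At least
  -- three zeros remain because `R ≥ 4`, so the copy cannot start in the first series before its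
  -- final zeros; starting later, it has a zero where the `1` should be.
  by_contra hne
  obtain ⟨j, hj, hm⟩ := (hP.2 _ hi').1.exists_letter_match (by omega)
  rcases lt_or_ge (j + 2) Z with hjZ | hjZ
  · refine not_three_zeros (σ := σ) (q := q) (m := m) (R := R) (j := j) hjZ fun t ht => ?_
    rw [hm t (by omega)]
    exact letter_zero_of_le (by omega) (by omega)
  · have := hm (Z + R - start P (i + 1)) (by omega)
    rw [Nat.add_sub_cancel' (by omega), hone, letter_zero_of_le (by omega) (by omega)] at this
    omega

/-- The greedy phrases in the second series are its blocks. -/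
theorem start_succ_second (hq : 1 ≤ q) (hm : m < σ ^ q)
    (hP : IsGreedyParsing (hardString σ q m R) P) {i k : ℕ} (hk : k < m)
    (hi : start P i = (m + 1) * (2 * q + 3) + R + 1 + k * (2 * q + 4)) :
    start P (i + 1) = (m + 1) * (2 * q + 3) + R + 1 + (k + 1) * (2 * q + 4) := by
  have hlen := length_hardString (σ := σ) (q := q) (m := m) (R := R)
  have hend := block_end_le (o := 2 * q + 3) (H := 2 * q + 4) hk (by omega)
  have hiP : i < P.length := hP.isParsing.lt_length_of_start_lt (by omega)
  have hmatch : ∀ t < 2 * q + 4, letter σ q m R (start P i + t) = blockLetter σ q k t := by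
    intro t ht
    rw [hi, add_assoc, letter_second hk ht]
  have hkA := block_end_le (i := k) (m := m + 1) (o := 0) (H := 2 * q + 3) (by omega) (by omega)
  -- The code and two zeros come from the first series; the third zero is the free last letter.
  have hge := (hP.2 _ hiP).le_of_letter_match (l := 2 * q + 4) (j := k * (2 * q + 3))
    (by omega) (by omega) (by omega) fun t ht => by
      rw [hmatch t (by omega), letter_first hk.le (by omega)]
  have hle : P[i].length ≤ 2 * q + 4 := by
    by_contra! hc
    obtain ⟨j, hj, hjm⟩ := (hP.2 _ hiP).1.exists_letter_match (by omega)
    have hjk := match_block (σ := σ) (R := R) (j := j) hq hm hk (by omega) fun t ht => by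
      rw [hjm t (by omega), hmatch t (by omega)]
    -- In the first series the only source continues with the leading `1` of block `k + 1`, not with
    -- a third zero. That block exists even for `k = m - 1`, since the first series has `m + 1`
    -- blocks.
    have := hjm (2 * q + 3) (by omega)
    rw [hmatch _ (by omega), blockLetter_of_lt (by omega), hjk,
      show k * (2 * q + 3) + (2 * q + 3) = (k + 1) * (2 * q + 3) + 0 by ring,
      letter_first hk (by omega), blockLetter_even (by omega) rfl] at this
    omega
  rw [start_succ P hiP, add_mul k]
  omega

theorem exists_starts_second (hR : 4 ≤ R) (hq : 1 ≤ q) (hm : m < σ ^ q)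
    (hP : IsGreedyParsing (hardString σ q m R) P) : ∃ i₀, ∀ k ≤ m,
      start P (i₀ + k) = (m + 1) * (2 * q + 3) + R + 1 + k * (2 * q + 4) := by
  obtain ⟨i₀, h₀⟩ := exists_start_eq_second hR hP
  refine ⟨i₀, fun k => ?_⟩
  induction k with
  | zero => intro _; simpa using h₀
  | succ k ih => intro hk; exact start_succ_second hq hm hP hk (ih (by omega))

/-- In every encoding of the greedy parsing, the blocks of the second series refer to the first
series. -/
theorem le_distance_second (hq : 1 ≤ q) (hm : m < σ ^ q)
    (hP : IsGreedyParsing (hardString σ q m R) P) {i k : ℕ} (hk : k < m) (hiP : i < P.length)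
    (hi : start P i = (m + 1) * (2 * q + 3) + R + 1 + k * (2 * q + 4)) {t : Triple}
    (ht : Represents (hardString σ q m R) (start P i) P[i] t) : R ≤ t.d := by
  have hs := start_succ P hiP
  have hlen := length_hardString (σ := σ) (q := q) (m := m) (R := R)
  rw [start_succ_second hq hm hP hk hi, hi, add_mul k] at hs
  have hend := block_end_le (o := 2 * q + 3) (H := 2 * q + 4) hk (by omega)
  rcases ht.2.2 with h | ⟨_, j, hj, ho, hd⟩
  · omega
  obtain ⟨j, rfl⟩ : ∃ i, j = i + 1 := ⟨j - 1, by have := ho.1; omega⟩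
  rw [(hP.2 i hiP).1.eq_take, dropLast_take_drop (hP.2 i hiP).1.add_length_le,
    occursAt_iff (by omega)] at ho
  have hjk := match_block (σ := σ) (R := R) (j := j) hq hm hk (by omega) fun t ht => by
    have := (getElem?_hardString_eq_iff (by omega) (by omega)).1 (ho t (by omega))
    rw [this, hi, add_assoc, letter_second hk (by omega)]
  have hkA := block_end_le (i := k) (m := m + 1) (o := 0) (H := 2 * q + 3) (by omega) (by omega)
  omega

theorem le_greedyCount_hardString (hR : 4 ≤ R) (hq : 1 ≤ q) (hm : m < σ ^ q) :
    m ≤ greedyCount (hardString σ q m R) := by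
  have hP := greedyParsing_spec (hardString σ q m R)
  obtain ⟨i₀, h⟩ := exists_starts_second hR hq hm hP
  have hlen := length_hardString (σ := σ) (q := q) (m := m) (R := R)
  rcases Nat.eq_zero_or_pos m with rfl | h0
  · simp
  have h1 := h (m - 1) (by omega)
  have hend := block_end_le (i := m - 1) (m := m) (o := 0) (H := 2 * q + 4) (by omega) (by omega)
  have := hP.isParsing.lt_length_of_start_lt (i := i₀ + (m - 1)) (by omega)
  unfold greedyCount
  omega

theorem le_LZgr_hardString {ed el ec : ℕ → List Bool} {a : ℝ} (ha0 : 0 < a)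
    (ha : ∀ x : ℕ, 1 ≤ x → a * Real.logb 2 ((x : ℝ) + 1) ≤ ((ed x).length : ℝ))
    (hR : 4 ≤ R) (hq : 1 ≤ q) (hm : m < σ ^ q) :
    m * (a * Real.logb 2 R) ≤ LZgr ed el ec (hardString σ q m R) := by
  have hP := greedyParsing_spec (hardString σ q m R)
  obtain ⟨i₀, h⟩ := exists_starts_second hR hq hm hP
  have hlen := length_hardString (σ := σ) (q := q) (m := m) (R := R)
  obtain ⟨T, hT, hL⟩ := exists_LZgr ed el ec (hardString σ q m R)
  rw [← hL, encode_length_eq_sum, hT.1, Nat.cast_sum]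
  set P := greedyParsing (hardString σ q m R)
  have hlt : ∀ k < m, i₀ + k < P.length := fun k hk => by
    have hend := block_end_le (i := k) (m := m) (o := 0) (H := 2 * q + 4) hk (by omega)
    have := h k hk.le
    exact hP.isParsing.lt_length_of_start_lt (by omega)
  calc m * (a * Real.logb 2 R)
      = ∑ _k ∈ Finset.range m, a * Real.logb 2 R := by simp
    _ ≤ ∑ k ∈ Finset.range m, (tripleSize ed el ec (T.getD (i₀ + k) default) : ℝ) := by
        refine Finset.sum_le_sum fun k hk => ?_
        rw [Finset.mem_range] at hk
        have hk' : i₀ + k < T.length := by rw [hT.1]; exact hlt k hk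
        have hd := le_distance_second hq hm hP hk (hlt k hk) (h k hk.le)
          (hT.2 _ (hlt k hk) hk')
        rw [List.getD_eq_getElem _ _ hk', tripleSize]
        have h1 := ha T[i₀ + k].d (by omega)
        have h2 : Real.logb 2 R ≤ Real.logb 2 (T[i₀ + k].d + 1) :=
          Real.logb_le_logb_of_le (by norm_num) (by positivity) (by exact_mod_cast Nat.le_succ_of_le hd)
        push_cast
        nlinarith [Nat.cast_nonneg (α := ℝ) (el T[i₀ + k].l).length,
          Nat.cast_nonneg (α := ℝ) (ec T[i₀ + k].c).length]
    _ = ∑ k ∈ Finset.Ico i₀ (i₀ + m), (tripleSize ed el ec (T.getD k default) : ℝ) := by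
        rw [Finset.sum_Ico_eq_sum_range, Nat.add_sub_cancel_left]
    _ ≤ _ := by
        refine Finset.sum_le_sum_of_subset_of_nonneg (fun k hk => ?_) fun _ _ _ => by positivity
        rw [Finset.mem_Ico] at hk
        have := hlt (k - i₀) (by omega)
        rw [Finset.mem_range]; omega

end Greedy

/-! ### Assembling parsings from consecutive pieces -/

/-- The triples `T` represent consecutive phrases of `s` from position `p` to position `p'`. -/
inductive Path (s : List ℕ) : ℕ → ℕ → List Triple → Prop
  | nil (p : ℕ) : Path s p p []
  | cons {p l p' : ℕ} {t : Triple} {T : List Triple} (hl : p + l ≤ s.length)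
      (ht : Represents s p ((s.drop p).take l) t) (hT : Path s (p + l) p' T) : Path s p p' (t :: T)

theorem Path.append {s : List ℕ} {p p' p'' : ℕ} {T T' : List Triple} (h : Path s p p' T)
    (h' : Path s p' p'' T') : Path s p p'' (T ++ T') := by
  induction h with
  | nil => exact h'
  | cons hl ht _ ih => exact .cons hl ht (ih h')

theorem Represents.isPhrase {s f : List ℕ} {p : ℕ} {t : Triple} (h : Represents s p f t)
    (hf : f <+: s.drop p) : IsPhrase s p f :=
  ⟨hf, h.2.2.imp (fun h => h.1) fun ⟨h1, j, hj, ho, _⟩ => ⟨h1, j, hj, ho⟩⟩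

theorem Path.exists_phrases {s : List ℕ} {p p' : ℕ} {T : List Triple} (h : Path s p p' T)
    (hp' : p' = s.length) : ∃ Q : List (List ℕ), Q.flatten = s.drop p ∧ T.length = Q.length ∧
      ∀ (i : ℕ) (hQ : i < Q.length) (hT : i < T.length),
        IsPhrase s (p + start Q i) Q[i] ∧ Represents s (p + start Q i) Q[i] T[i] := by
  induction h with
  | nil p => exact ⟨[], by simp [hp'], rfl, by simp⟩
  | @cons p l p' t T hl ht _ ih =>
    obtain ⟨Q, h1, h2, h3⟩ := ih hp'
    have hlen : ((s.drop p).take l).length = l := by simp; omega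
    refine ⟨(s.drop p).take l :: Q, ?_, by simp [h2], ?_⟩
    · rw [List.flatten_cons, h1, ← List.drop_drop, List.take_append_drop]
    · rintro (_ | i) hQ hT
      · simpa [start_zero] using ⟨ht.isPhrase (List.take_prefix _ _), ht⟩
      · rw [start_cons, hlen, ← add_assoc]
        simpa using h3 i (by simpa using hQ) (by simpa using hT)

theorem Path.exists_parsing {s : List ℕ} {T : List Triple} (h : Path s 0 s.length T) :
    ∃ Q, IsParsing s Q ∧ RepresentsAll s Q T := by
  obtain ⟨Q, h1, h2, h3⟩ := h.exists_phrases rfl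
  simp only [zero_add] at h3
  exact ⟨Q, ⟨by simpa using h1, fun i hi => (h3 i hi (by omega)).1⟩, h2,
    fun i hi hi' => (h3 i hi hi').2⟩

/-- The part of `s` from `p` to `p'` can be parsed into at most `N` phrases whose encoding has at
most `B` bits. -/
def Reach (ed el ec : ℕ → List Bool) (s : List ℕ) (p p' N : ℕ) (B : ℝ) : Prop :=
  ∃ T, Path s p p' T ∧ T.length ≤ N ∧ ((encode ed el ec T).length : ℝ) ≤ B

section Reach
variable {ed el ec : ℕ → List Bool} {s : List ℕ} {p p' p'' N N' : ℕ} {B B' : ℝ}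

theorem Reach.refl (p : ℕ) : Reach ed el ec s p p 0 0 := ⟨[], .nil p, by simp, by simp [encode]⟩

theorem Reach.trans (h : Reach ed el ec s p p' N B) (h' : Reach ed el ec s p' p'' N' B') :
    Reach ed el ec s p p'' (N + N') (B + B') := by
  obtain ⟨T, h1, h2, h3⟩ := h
  obtain ⟨T', h1', h2', h3'⟩ := h'
  refine ⟨T ++ T', h1.append h1', by simp; omega, ?_⟩
  have : encode ed el ec (T ++ T') = encode ed el ec T ++ encode ed el ec T' := by simp [encode]
  rw [this, List.length_append]
  push_cast
  linarith

theorem Reach.mono (h : Reach ed el ec s p p' N B) (hN : N ≤ N') (hB : B ≤ B') :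
    Reach ed el ec s p p' N' B' := by
  obtain ⟨T, h1, h2, h3⟩ := h
  exact ⟨T, h1, h2.trans hN, h3.trans hB⟩

theorem Reach.iterate {H : ℕ} (m : ℕ) (h : ∀ i < m,
      Reach ed el ec s (p + i * H) (p + (i + 1) * H) N B) :
    Reach ed el ec s p (p + m * H) (m * N) (m * B) := by
  induction m with
  | zero => simpa using Reach.refl p
  | succ m ih =>
    have := (ih fun i hi => h i (by omega)).trans (h m (by omega))
    refine this.mono (by rw [add_mul, one_mul]) (by push_cast; linarith)

theorem reach_single {c : ℕ} (hc : s[p]? = some c)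
    (hB : (tripleSize ed el ec ⟨0, 1, c⟩ : ℝ) ≤ B) : Reach ed el ec s p (p + 1) 1 B := by
  obtain ⟨hp, hc'⟩ := List.getElem?_eq_some_iff.1 hc
  have e : (s.drop p).take 1 = [c] := by
    rw [List.drop_eq_getElem_cons hp, hc']; simp
  refine ⟨[⟨0, 1, c⟩], .cons (l := 1) hp ?_ (.nil _), by simp, ?_⟩
  · rw [e]; exact ⟨rfl, rfl, Or.inl ⟨rfl, rfl⟩⟩
  · rw [encode_length]; simpa using hB

/-- A phrase copied from distance `D`. -/
theorem reach_copy {c D l : ℕ} (hl : 2 ≤ l) (hD : 1 ≤ D) (hDp : D ≤ p)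
    (hc : s[p + l - 1]? = some c) (hm : ∀ t < l - 1, s[p - D + t]? = s[p + t]?)
    (hB : (tripleSize ed el ec ⟨D - 1, l, c⟩ : ℝ) ≤ B) : Reach ed el ec s p (p + l) 1 B := by
  obtain ⟨hp, hc'⟩ := List.getElem?_eq_some_iff.1 hc
  have hle : p + l ≤ s.length := by omega
  have hlen : ((s.drop p).take l).length = l := by simp; omega
  refine ⟨[⟨D - 1, l, c⟩], .cons (l := l) hle ?_ (.nil _), by simp, ?_⟩
  · refine ⟨hlen.symm, ?_, Or.inr ⟨by omega, p - D + 1, by omega, ?_, by dsimp only; omega⟩⟩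
    · rw [List.getLast?_eq_getElem?, hlen, List.getElem?_take_of_lt (by omega),
        List.getElem?_drop, ← Nat.add_sub_assoc (by omega), hc]
    · rw [dropLast_take_drop hle, occursAt_iff (by omega)]
      exact hm
  · rw [encode_length]; simpa using hB

end Reach

/-! ### A cheap parsing of the hard string -/

section Hard
variable {ed el ec : ℕ → List Bool} {σ q m R : ℕ} {w : ℝ}

theorem reach_letter (hσ : 2 ≤ σ) (hw : ∀ d l c, d ≤ 2 * q + 4 → l ≤ 2 * q + 4 → c < σ →
      (tripleSize ed el ec ⟨d, l, c⟩ : ℝ) ≤ w) {p : ℕ}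
    (hp : p < (hardString σ q m R).length) :
    Reach ed el ec (hardString σ q m R) p (p + 1) 1 w :=
  reach_single (getElem?_hardString hp)
    (hw _ _ _ (by omega) (by omega) (letter_lt hσ (by rwa [length_hardString] at hp)))

theorem reach_letter_copy (hσ : 2 ≤ σ) (hw : ∀ d l c, d ≤ 2 * q + 4 → l ≤ 2 * q + 4 → c < σ →
      (tripleSize ed el ec ⟨d, l, c⟩ : ℝ) ≤ w) {p l D : ℕ}
    (hp : p + l ≤ (hardString σ q m R).length) (hl : 1 ≤ l) (hlq : l ≤ 2 * q + 4)
    (hD : 1 ≤ D) (hDq : D ≤ 2 * q + 4) (hDp : D ≤ p)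
    (hm : ∀ t < l - 1, letter σ q m R (p - D + t) = letter σ q m R (p + t)) :
    Reach ed el ec (hardString σ q m R) p (p + l) 1 w := by
  rcases Nat.eq_or_lt_of_le hl with rfl | hl
  · exact reach_letter hσ hw (by omega)
  · exact reach_copy hl hD hDp (getElem?_hardString (by omega))
      (fun t ht => (getElem?_hardString_eq_iff (by omega) (by omega)).2 (hm t ht))
      (hw _ _ _ (by omega) hlq (letter_lt hσ (by rw [← length_hardString]; omega)))

/-- A block takes at most four short phrases. -/
theorem reach_block (hσ : 2 ≤ σ) (hq : 1 ≤ q)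
    (hw : ∀ d l c, d ≤ 2 * q + 4 → l ≤ 2 * q + 4 → c < σ →
      (tripleSize ed el ec ⟨d, l, c⟩ : ℝ) ≤ w) {p H i : ℕ}
    (hH : 2 * q + 3 ≤ H) (hH' : H ≤ 2 * q + 4) (hi : i < σ ^ q)
    (hp : p + H ≤ (hardString σ q m R).length)
    (hb : ∀ o < H, letter σ q m R (p + o) = blockLetter σ q i o)
    (hprev : 1 ≤ i → H ≤ p ∧ ∀ o < H, letter σ q m R (p - H + o) = blockLetter σ q (i - 1) o) :
    Reach ed el ec (hardString σ q m R) p (p + H) 4 (4 * w) := by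
  have hw0 : 0 ≤ w := le_trans (Nat.cast_nonneg _) (hw 0 0 0 (by omega) (by omega) (by omega))
  have two : Reach ed el ec (hardString σ q m R) p (p + 2) (1 + 1) (w + w) :=
    (reach_letter hσ hw (by omega)).trans (reach_letter hσ hw (by omega))
  -- When the `t` lowest digits vanish, the letters alternate `1, 0, 1, 0, …` and are copied at
  -- distance `2`. The last letter, at offset `2t + 1`, is free and holds digit `t`, the one changed
  -- by the carry.
  have run : ∀ t < q, (∀ k < t, i / σ ^ k % σ = 0) →
      Reach ed el ec (hardString σ q m R) p (p + (2 * t + 2)) (1 + 1 + 1) (w + w + w) := by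
    intro t ht hz
    rcases Nat.eq_zero_or_pos t with rfl | ht0
    · exact two.mono (by omega) (by linarith)
    · have := two.trans (reach_letter_copy hσ hw (p := p + 2) (l := 2 * t) (D := 2)
        (by omega) (by omega) (by omega) (by omega) (by omega) (by omega) fun o ho => by
          rw [Nat.add_sub_cancel, hb _ (by omega), add_assoc, hb _ (by omega)]
          rcases Nat.mod_two_eq_zero_or_one o with h | h
          · rw [blockLetter_even (by omega) h, blockLetter_even (by omega) (by omega)]
          · rw [blockLetter_odd (by omega) h, blockLetter_odd (by omega) (by omega),
              hz _ (by omega), hz _ (by omega)])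
      rwa [add_assoc p, add_comm 2] at this
  rcases Nat.eq_zero_or_pos i with rfl | hi0
  -- The block of `0` has no predecessor, but it is periodic as far as the first separating zero;
  -- the second is the free last letter, and a third, if present, is written separately.
  · have h3 := two.trans (reach_letter_copy hσ hw (p := p + 2) (l := 2 * q + 1) (D := 2)
      (by omega) (by omega) (by omega) (by omega) (by omega) (by omega) fun o ho => by
        rw [Nat.add_sub_cancel, hb _ (by omega), add_assoc, hb _ (by omega)]
        rcases Nat.mod_two_eq_zero_or_one o with h | h
        · rcases Nat.eq_or_lt_of_le (show o ≤ 2 * q by omega) with rfl | hlt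
          · omega
          · rw [blockLetter_even (by omega) h, blockLetter_even (by omega) (by omega)]
        · rw [blockLetter_odd (by omega) h]
          rcases le_or_gt (2 + o) (2 * q) with hlt | hlt
          · rw [blockLetter_odd hlt (by omega)]; simp
          · rw [blockLetter_of_lt hlt]; simp)
    rcases Nat.eq_or_lt_of_le hH with rfl | hlt
    · rw [add_assoc p, add_comm 2] at h3
      exact h3.mono (by omega) (by linarith)
    · obtain rfl : H = 2 * q + 4 := by omega
      have := h3.trans (reach_letter hσ hw (by omega))
      rw [show p + 2 + (2 * q + 1) + 1 = p + (2 * q + 4) by ring] at this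
      exact this.mono (by omega) (by linarith)
  · obtain ⟨i, rfl⟩ : ∃ k, i = k + 1 := ⟨i - 1, by omega⟩
    obtain ⟨t, ht, hz, he⟩ := exists_carry hσ hi
    obtain ⟨hHp, hpr⟩ := hprev (by omega)
    -- Above the carry the block agrees with the previous one, which lies at distance `H`.
    have := (run t ht hz).trans (reach_letter_copy hσ hw (p := p + (2 * t + 2))
      (l := H - (2 * t + 2)) (D := H)
      (by omega) (by omega) (by omega) (by omega) (by omega) (by omega) fun o ho => by
        rw [add_assoc, hb _ (by omega), show p + (2 * t + 2) - H + o = p - H + (2 * t + 2 + o) by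
          omega, hpr _ (by omega), Nat.add_sub_cancel]
        rcases le_or_gt (2 * t + 2 + o) (2 * q) with hle | hlt
        · rcases Nat.mod_two_eq_zero_or_one o with h | h
          · rw [blockLetter_even hle (by omega), blockLetter_even hle (by omega)]
          · rw [blockLetter_odd hle (by omega), blockLetter_odd hle (by omega), he _ (by omega)]
        · rw [blockLetter_of_lt hlt, blockLetter_of_lt hlt])
    rw [show p + (2 * t + 2) + (H - (2 * t + 2)) = p + H by omega] at this
    exact this.mono (by omega) (by linarith)

theorem reach_hardString (hσ : 2 ≤ σ) (hq : 1 ≤ q) (hm : m < σ ^ q) (hR : 4 ≤ R)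
    (hw : ∀ d l c, d ≤ 2 * q + 4 → l ≤ 2 * q + 4 → c < σ →
      (tripleSize ed el ec ⟨d, l, c⟩ : ℝ) ≤ w) :
    Reach ed el ec (hardString σ q m R) 0 (hardString σ q m R).length (8 * m + 6 + σ)
      ((8 * m + 5 + σ) * w + tripleSize ed el ec ⟨0, R, 1⟩) := by
  have hlen := length_hardString (σ := σ) (q := q) (m := m) (R := R)
  have hA : Reach ed el ec (hardString σ q m R) 0 (0 + (m + 1) * (2 * q + 3)) ((m + 1) * 4)
      ((m + 1 : ℕ) * (4 * w)) := by
    refine Reach.iterate (m + 1) fun i hi => ?_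
    have hend := block_end_le (i := i) (m := m + 1) (o := 2 * q + 2) (H := 2 * q + 3) hi (by omega)
    have := reach_block (ed := ed) (el := el) (ec := ec) (w := w) (m := m) (R := R) hσ hq hw
      (p := 0 + i * (2 * q + 3)) (H := 2 * q + 3) (i := i) le_rfl (by omega) (by omega) (by omega)
      (fun o ho => by rw [zero_add]; exact letter_first (by omega) ho) (fun h1 => by
        obtain ⟨i, rfl⟩ : ∃ k, i = k + 1 := ⟨i - 1, by omega⟩
        have e : 0 + (i + 1) * (2 * q + 3) = i * (2 * q + 3) + (2 * q + 3) := by ring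
        refine ⟨by omega, fun o ho => ?_⟩
        rw [e, Nat.add_sub_cancel, Nat.add_sub_cancel]
        exact letter_first (by omega) ho)
    convert this using 1
    ring
  have hZ : Reach ed el ec (hardString σ q m R) (0 + (m + 1) * (2 * q + 3))
      ((m + 1) * (2 * q + 3) + R + 1) (1 + 1) (w + tripleSize ed el ec ⟨0, R, 1⟩) := by
    rw [zero_add]
    -- One literal zero, then a copy at distance `1` that supplies the other `R - 1` zeros and ends
    -- with the `1`. Only this phrase is long.
    refine (reach_letter hσ hw (by omega)).trans ?_
    have := reach_copy (ed := ed) (el := el) (ec := ec) (s := hardString σ q m R)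
      (p := (m + 1) * (2 * q + 3) + 1) (l := R) (D := 1) (c := 1) (by omega) le_rfl (by omega)
      (by rw [show (m + 1) * (2 * q + 3) + 1 + R - 1 = (m + 1) * (2 * q + 3) + R by omega,
            getElem?_hardString (by omega), letter_one])
      (fun t ht => by
        rw [getElem?_hardString_eq_iff (by omega) (by omega), letter_zero (by omega) (by omega),
          letter_zero (by omega) (by omega)])
      le_rfl
    convert this using 1
    ring
  have hB : Reach ed el ec (hardString σ q m R) ((m + 1) * (2 * q + 3) + R + 1)
      ((m + 1) * (2 * q + 3) + R + 1 + m * (2 * q + 4)) (m * 4) (m * (4 * w)) := by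
    refine Reach.iterate m fun i hi => ?_
    have hend := block_end_le (i := i) (m := m) (o := 2 * q + 3) (H := 2 * q + 4) hi (by omega)
    have := reach_block (ed := ed) (el := el) (ec := ec) (w := w) (m := m) (R := R) hσ hq hw
      (p := (m + 1) * (2 * q + 3) + R + 1 + i * (2 * q + 4)) (H := 2 * q + 4) (i := i)
      (by omega) le_rfl (by omega) (by omega)
      (fun o ho => by rw [add_assoc _ _ o]; exact letter_second hi ho) (fun h1 => by
        obtain ⟨i, rfl⟩ : ∃ k, i = k + 1 := ⟨i - 1, by omega⟩
        have e : (i + 1) * (2 * q + 4) = i * (2 * q + 4) + (2 * q + 4) := by ring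
        refine ⟨by omega, fun o ho => ?_⟩
        rw [e, ← add_assoc, Nat.add_sub_cancel, Nat.add_sub_cancel, add_assoc _ _ o]
        exact letter_second (by omega) ho)
    convert this using 1
    ring
  have hT : Reach ed el ec (hardString σ q m R) ((m + 1) * (2 * q + 3) + R + 1 + m * (2 * q + 4))
      ((m + 1) * (2 * q + 3) + R + 1 + m * (2 * q + 4) + σ * 1) (σ * 1) (σ * w) :=
    Reach.iterate σ fun i hi => by
      rw [mul_one, mul_one, ← add_assoc]
      exact reach_letter hσ hw (by omega)
  have := ((hA.trans hZ).trans hB).trans hT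
  rw [mul_one, ← hlen] at this
  refine this.mono (by omega) (le_of_eq ?_)
  push_cast
  ring

theorem hardString_parsing (hσ : 2 ≤ σ) (hq : 1 ≤ q) (hm : m < σ ^ q) (hR : 4 ≤ R)
    (hw : ∀ d l c, d ≤ 2 * q + 4 → l ≤ 2 * q + 4 → c < σ →
      (tripleSize ed el ec ⟨d, l, c⟩ : ℝ) ≤ w) :
    greedyCount (hardString σ q m R) ≤ 8 * m + 6 + σ ∧
    (LZopt ed el ec (hardString σ q m R) : ℝ) ≤
      (8 * m + 5 + σ) * w + tripleSize ed el ec ⟨0, R, 1⟩ := by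
  obtain ⟨T, hT, hN, hB⟩ := reach_hardString hσ hq hm hR hw
  obtain ⟨Q, hQ, hr⟩ := hT.exists_parsing
  refine ⟨((greedyParsing_spec _).length_le hQ).trans (by rw [← hr.1]; exact hN), ?_⟩
  exact (Nat.cast_le.2 (LZopt_le hQ hr)).trans hB

end Hard

/-! ### Choice of parameters and the lower bound -/

/-- The inequalities that hold for all large `x = log n`. -/
structure LargeLog (ε C x : ℝ) : Prop where
  eight_le : 8 ≤ x
  rpow_le : x ^ C ≤ 2 ^ (x ^ ε)
  self_le : x ≤ 2 ^ (x ^ ε)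
  mul_le : 200 * ((2 ^ (x ^ ε) + 2) * x) ≤ 2 ^ x

theorem eventually_largeLog {ε C : ℝ} (hε₀ : 0 < ε) (hε₁ : ε < 1) :
    ∀ᶠ x : ℝ in atTop, LargeLog ε C x := by
  filter_upwards [eventually_ge_atTop 8, eventually_add_mul_logb_le_rpow 0 C hε₀,
    eventually_add_mul_logb_le_rpow 0 1 hε₀,
    eventually_add_mul_logb_le_rpow 2 0 (sub_pos.2 hε₁),
    eventually_add_mul_logb_le_rpow 20 2 zero_lt_one] with x h1 h2 h3 h4 h5
  have hx : 0 < x := by linarith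
  have e2 : (2 : ℝ) ^ Real.logb 2 x = x := Real.rpow_logb (by norm_num) (by norm_num) hx
  refine ⟨h1, ?_, ?_, ?_⟩
  · calc x ^ C = 2 ^ (Real.logb 2 x * C) := by rw [Real.rpow_mul (by norm_num), e2]
      _ ≤ _ := Real.rpow_le_rpow_of_exponent_le (by norm_num) (by linarith)
  · calc x = 2 ^ Real.logb 2 x := e2.symm
      _ ≤ _ := Real.rpow_le_rpow_of_exponent_le (by norm_num) (by linarith)
  · have hε : 2 * x ^ ε ≤ x := by
      have e : x = x ^ (1 - ε) * x ^ ε := by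
        rw [← Real.rpow_add hx]; simp
      have := Real.rpow_nonneg hx.le ε
      nlinarith
    rw [Real.rpow_one] at h5
    have hW : (1 : ℝ) ≤ 2 ^ (x ^ ε) := Real.one_le_rpow (by norm_num) (by positivity)
    calc 200 * ((2 ^ (x ^ ε) + 2) * x) ≤ 1024 * (2 ^ (x ^ ε) * x) := by nlinarith
      _ = 2 ^ (10 + (x ^ ε + Real.logb 2 x)) := by
          rw [Real.rpow_add (by norm_num), Real.rpow_add (by norm_num), e2]; norm_num
      _ ≤ _ := Real.rpow_le_rpow_of_exponent_le (by norm_num) (by linarith)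

theorem exists_tripleSize_le {ed el ec : ℕ → List Bool} (hed : IsLogEncoder ed)
    (hel : IsLogEncoder el) (hec : IsLogEncoder ec) :
    ∃ K : ℝ, 0 < K ∧ ∀ (d l c : ℕ) (y : ℝ), 2 ≤ y → (d : ℝ) ≤ y → (l : ℝ) ≤ y → (c : ℝ) ≤ y →
      (tripleSize ed el ec ⟨d, l, c⟩ : ℝ) ≤ K * Real.logb 2 y := by
  obtain ⟨K₁, h₁, hK₁⟩ := hed.exists_length_le
  obtain ⟨K₂, h₂, hK₂⟩ := hel.exists_length_le
  obtain ⟨K₃, h₃, hK₃⟩ := hec.exists_length_le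
  refine ⟨K₁ + K₂ + K₃, by positivity, fun d l c y hy h1 h2 h3 => ?_⟩
  simp only [tripleSize]
  push_cast
  linarith [hK₁ d y hy h1, hK₂ l y hy h2, hK₃ c y hy h3]

/-- Everything except the zero run must fit into half of the length, so that `R ≥ n/2`. It has size
`O(m log_σ n)`, which `z ≤ n / log_σ n` keeps small once `m` is about `z / 200`. -/
theorem LargeLog.exists_parameters {ε C : ℝ} {n σ z : ℕ}
    (hx : LargeLog ε C (Real.logb 2 n)) (hn : 0 < n) (hσ : 2 ≤ σ)
    (hσC : (σ : ℝ) ≤ Real.logb 2 n ^ C) (hz : (2 : ℝ) ^ (Real.logb 2 n ^ ε) ≤ z)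
    (hzn : (z : ℝ) ≤ n / Real.logb σ n) :
    ∃ q m R : ℕ, 1 ≤ q ∧ (q : ℝ) ≤ Real.logb 2 n + 1 ∧ m < σ ^ q ∧ m ≤ z ∧ z ≤ 200 * m ∧
      (2 : ℝ) ^ (Real.logb 2 n ^ ε) ≤ m ∧ 4 ≤ R ∧ n ≤ 2 * R ∧ σ ≤ n ∧
      (hardString σ q m R).length = n := by
  obtain ⟨h8, hC, hself, hmul⟩ := hx
  have hn' : (0 : ℝ) < n := by exact_mod_cast hn
  rw [Real.rpow_logb (by norm_num) (by norm_num) hn'] at hmul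
  set x := Real.logb 2 n with hxdef
  set W : ℝ := 2 ^ (x ^ ε) with hW
  have hσ' : (2 : ℝ) ≤ σ := by exact_mod_cast hσ
  have hW8 : 8 ≤ W := by linarith
  have hσn : 200 * (σ : ℝ) ≤ n := by nlinarith
  have hx200 : 400 * x ≤ n := by nlinarith
  set y := Real.logb σ n with hy
  have hy1 : 1 ≤ y := by
    rw [hy, Real.le_logb_iff_rpow_le (by linarith) hn', Real.rpow_one]; linarith
  have hyx : y ≤ x := by
    rw [hy, hxdef, Real.logb, Real.logb]
    refine div_le_div_of_nonneg_left (Real.log_nonneg ?_) (Real.log_pos (by norm_num))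
      (Real.log_le_log (by norm_num) hσ')
    exact_mod_cast hn
  have hzy : z * y ≤ n := (le_div_iff₀ (by linarith)).1 hzn
  have hzle : (z : ℝ) ≤ n := by nlinarith [Nat.cast_nonneg (α := ℝ) z]
  set q := Nat.log σ n + 1 with hq
  have hqy : (q : ℝ) ≤ y + 1 := by
    have := Real.natLog_le_logb n σ
    rw [hq]; push_cast; linarith
  -- The maximum with `W` keeps the greedy parsing at least `2^(x^ε)` phrases long even when `z /
  -- 200` is smaller.
  set m := max ⌈W⌉₊ ⌈(z : ℝ) / 200⌉₊ with hm
  have hmW : W ≤ m := (Nat.le_ceil W).trans (by exact_mod_cast le_max_left _ _)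
  have hmz : (z : ℝ) / 200 ≤ m := (Nat.le_ceil _).trans (by exact_mod_cast le_max_right _ _)
  have hmle : m ≤ z := max_le (Nat.ceil_le.2 hz) (Nat.ceil_le.2 (by linarith [hz]))
  have hmy : 100 * (m * y) ≤ n := by
    have h1 : (m : ℝ) ≤ max (W + 1) (z / 200 + 1) := by
      rw [hm, Nat.cast_max]
      exact max_le_max (Nat.ceil_lt_add_one (by linarith)).le
        (Nat.ceil_lt_add_one (by positivity)).le
    rcases le_max_iff.1 h1 with h | h <;> nlinarith
  have hm1 : (1 : ℝ) ≤ m := by linarith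
  have hrest : 2 * (((m + 1) * (2 * q + 3) + 1 + m * (2 * q + 4) + σ : ℕ) : ℝ) ≤ n := by
    push_cast
    have e1 : 2 * (q : ℝ) + 3 ≤ 7 * y := by linarith
    have e2 : 2 * (q : ℝ) + 4 ≤ 8 * y := by linarith
    have e3 : ((m : ℝ) + 1) * (2 * q + 3) ≤ (2 * m) * (7 * y) := by
      gcongr
      linarith
    have e4 : (m : ℝ) * (2 * q + 4) ≤ m * (8 * y) := by gcongr
    have e5 : 1 ≤ m * y := by nlinarith
    nlinarith
  have hrest' : 2 * ((m + 1) * (2 * q + 3) + 1 + m * (2 * q + 4) + σ) ≤ n := by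
    exact_mod_cast hrest
  have hn8 : 8 ≤ n := by
    have : (8 : ℝ) ≤ n := by linarith
    exact_mod_cast this
  refine ⟨q, m, n - ((m + 1) * (2 * q + 3) + 1 + m * (2 * q + 4) + σ), by omega, by linarith,
    ?_, hmle, ?_, hmW, by omega, by omega, by omega, by rw [length_hardString]; omega⟩
  · refine lt_of_le_of_lt (hmle.trans ?_) (Nat.lt_pow_succ_log_self (b := σ) (by omega) n)
    exact_mod_cast hzle
  · have : (z : ℝ) ≤ 200 * m := by linarith
    exact_mod_cast this

theorem greedy_lower_bound {ed el ec : ℕ → List Bool} (hed : IsLogEncoder ed)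
    (hel : IsLogEncoder el) (hec : IsLogEncoder ec) {ε C : ℝ} (hε₀ : 0 < ε) (hε₁ : ε < 1)
    (hC : 0 < C) :
    ∃ (c a b : ℝ) (N : ℕ), 0 < c ∧ 0 < a ∧ 0 < b ∧
      ∀ n σ z : ℕ, N ≤ n → 2 ≤ σ → (σ : ℝ) ≤ Real.logb 2 n ^ C →
        (2 : ℝ) ^ (Real.logb 2 n ^ ε) ≤ (z : ℝ) → (z : ℝ) ≤ n / Real.logb σ n →
        ∃ s : List ℕ, s.length = n ∧ (∀ x ∈ s, x ≤ n) ∧ alphabetSize s = σ ∧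
          a * z ≤ (greedyCount s : ℝ) ∧ (greedyCount s : ℝ) ≤ b * z ∧
          (2 : ℝ) ^ (Real.logb 2 n ^ ε) ≤ (greedyCount s : ℝ) ∧
          c * (Real.logb 2 n / Real.logb 2 (Real.logb 2 n)) ≤
            (LZgr ed el ec s : ℝ) / (LZopt ed el ec s : ℝ) := by
  obtain ⟨K, hK, hcost⟩ := exists_tripleSize_le hed hel hec
  obtain ⟨α, β, hα, hβ, hαβ⟩ := hed
  obtain ⟨N, hN⟩ := eventually_atTop.1
    (tendsto_logb_natCast_atTop.eventually (eventually_largeLog (C := C) hε₀ hε₁))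
  set D := K * (14 * (C + 2) + 1) with hD
  have hD0 : 0 < D := by positivity
  -- `D` bounds the optimal size divided by `m log x`, and the `2` comes from `log R ≥ x / 2`. The
  -- other constants come from `z ≤ 200 m` and `m ≤ z(s) ≤ 8m + 6 + σ ≤ 15 z`.
  refine ⟨α / (2 * D), 1 / 200, 15, max N 1, by positivity, by norm_num, by norm_num,
    fun n σ z hn hσ hσC hz hzn => ?_⟩
  have hlarge := hN n (le_of_max_le_left hn)
  have hn0 : 0 < n := le_of_max_le_right hn
  obtain ⟨q, m, R, hq, hqx, hmq, hmz, hzm, hWm, hR, hnR, hσn, hlen⟩ :=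
    hlarge.exists_parameters hn0 hσ hσC hz hzn
  obtain ⟨h8, hxC, hself, -⟩ := hlarge
  have hn' : (0 : ℝ) < n := by exact_mod_cast hn0
  set x := Real.logb 2 n with hxdef
  have hx0 : 0 < x := by linarith
  set ll := Real.logb 2 x with hll
  have hll1 : 1 ≤ ll := by
    rw [hll, Real.le_logb_iff_rpow_le (by norm_num) hx0, Real.rpow_one]; linarith
  have hσm : (σ : ℝ) ≤ m := by linarith
  have hm8 : (8 : ℝ) ≤ m := by linarith
  have hpow : x ^ (C + 2) = x ^ C * (x * x) := by
    rw [Real.rpow_add hx0, Real.rpow_two, sq]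
  have hpC : 1 ≤ x ^ C := Real.one_le_rpow (by linarith) hC.le
  have hxx : 8 * x ≤ x * x := by nlinarith
  have hbig : x * x ≤ x ^ (C + 2) := by rw [hpow]; nlinarith
  have hbig' : x ^ C ≤ x ^ (C + 2) := by rw [hpow]; nlinarith
  have hw : ∀ d l c, d ≤ 2 * q + 4 → l ≤ 2 * q + 4 → c < σ →
      (tripleSize ed el ec ⟨d, l, c⟩ : ℝ) ≤ K * ((C + 2) * ll) := by
    intro d l c hd hl hc
    have hd' : (d : ℝ) ≤ 2 * q + 4 := by exact_mod_cast hd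
    have hl' : (l : ℝ) ≤ 2 * q + 4 := by exact_mod_cast hl
    have hc' : (c : ℝ) ≤ σ := by exact_mod_cast hc.le
    rw [hll, ← Real.logb_rpow_eq_mul_logb_of_pos hx0]
    -- The common bound `x^(C+2)` dominates both `2q + 4 ≤ x²` and `σ ≤ x^C`, so each short phrase
    -- costs `O(log x)` bits.
    exact hcost d l c _ (by linarith) (by linarith) (by linarith) (by linarith)
  obtain ⟨hcount, hopt⟩ := hardString_parsing hσ hq hmq hR hw
  have hgr := le_LZgr_hardString (el := el) (ec := ec) hα (fun x hx => (hαβ x hx).1) hR hq hmq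
  have hge := le_greedyCount_hardString hR hq hmq
  set s := hardString σ q m R
  have hge' : (m : ℝ) ≤ greedyCount s := by exact_mod_cast hge
  have hcount' : (greedyCount s : ℝ) ≤ 8 * m + 6 + σ := by exact_mod_cast hcount
  have hmz' : (m : ℝ) ≤ z := by exact_mod_cast hmz
  have hzm' : (z : ℝ) ≤ 200 * m := by exact_mod_cast hzm
  refine ⟨s, hlen, fun c hc => ((mem_hardString hσ).1 hc).le.trans hσn,
    alphabetSize_hardString hσ, by linarith, by linarith, by linarith, ?_⟩
  have hpos : 0 < LZopt ed el ec s :=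
    LZopt_pos hel (List.ne_nil_of_length_pos (by omega))
  have hpos' : (0 : ℝ) < LZopt ed el ec s := by exact_mod_cast hpos
  rw [le_div_iff₀ hpos']
  have hrun : (tripleSize ed el ec ⟨0, R, 1⟩ : ℝ) ≤ K * x := by
    have hRn : (R : ℝ) ≤ n := by
      have : R ≤ n := by rw [← hlen, length_hardString]; omega
      exact_mod_cast this
    have hR4 : (4 : ℝ) ≤ R := by exact_mod_cast hR
    exact hcost 0 R 1 n (by linarith) (by simp) hRn (by push_cast; linarith)
  have hopt' : (LZopt ed el ec s : ℝ) ≤ D * (m * ll) := by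
    have e1 : (8 * m + 5 + σ : ℝ) * (K * ((C + 2) * ll)) ≤ 14 * m * (K * ((C + 2) * ll)) := by
      gcongr
      linarith
    -- The one long phrase is absorbed, as `m ≥ 2^(x^ε) ≥ x`.
    have e2 : K * x ≤ K * (m * ll) := by
      gcongr
      nlinarith
    calc (LZopt ed el ec s : ℝ) ≤ 14 * m * (K * ((C + 2) * ll)) + K * (m * ll) := by linarith
      _ = _ := by rw [hD]; ring
  have hlogR : x / 2 ≤ Real.logb 2 R := by
    have h1 : x ≤ Real.logb 2 (2 * R) :=
      Real.logb_le_logb_of_le (by norm_num) hn' (by exact_mod_cast hnR)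
    rw [Real.logb_mul (by norm_num) (by positivity), Real.logb_self_eq_one (by norm_num)] at h1
    linarith
  calc α / (2 * D) * (x / ll) * LZopt ed el ec s
      ≤ α / (2 * D) * (x / ll) * (D * (m * ll)) := by gcongr
    _ = m * (α * (x / 2)) := by field_simp
    _ ≤ m * (α * Real.logb 2 R) := by gcongr
    _ ≤ _ := hgr

end LZ77

theorem corollary2 (ed el ec : ℕ → List Bool) (hed : LZ77.IsLogEncoder ed)
    (hel : LZ77.IsLogEncoder el) (hec : LZ77.IsLogEncoder ec)
    (ε C : ℝ) (hε₀ : 0 < ε) (hε₁ : ε < 1) (hC : 0 < C) :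
    (∃ K : ℝ, 0 < K ∧ ∀ (n : ℕ) (s : List ℕ), 3 ≤ n → s.length = n → (∀ x ∈ s, x ≤ n) →
      (LZ77.alphabetSize s : ℝ) ≤ Real.logb 2 n ^ C →
      (2 : ℝ) ^ (Real.logb 2 n ^ ε) ≤ (LZ77.greedyCount s : ℝ) →
      0 < LZ77.LZopt ed el ec s ∧
      (LZ77.LZgr ed el ec s : ℝ) / (LZ77.LZopt ed el ec s : ℝ) ≤
        K * (Real.logb 2 n / Real.logb 2 (Real.logb 2 n))) ∧
    (∃ (c a b : ℝ) (N : ℕ), 0 < c ∧ 0 < a ∧ 0 < b ∧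
      ∀ n σ z : ℕ, N ≤ n → 2 ≤ σ → (σ : ℝ) ≤ Real.logb 2 n ^ C →
        (2 : ℝ) ^ (Real.logb 2 n ^ ε) ≤ (z : ℝ) → (z : ℝ) ≤ n / Real.logb σ n →
        ∃ s : List ℕ, s.length = n ∧ (∀ x ∈ s, x ≤ n) ∧ LZ77.alphabetSize s = σ ∧
          a * z ≤ (LZ77.greedyCount s : ℝ) ∧ (LZ77.greedyCount s : ℝ) ≤ b * z ∧
          (2 : ℝ) ^ (Real.logb 2 n ^ ε) ≤ (LZ77.greedyCount s : ℝ) ∧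
          c * (Real.logb 2 n / Real.logb 2 (Real.logb 2 n)) ≤
            (LZ77.LZgr ed el ec s : ℝ) / (LZ77.LZopt ed el ec s : ℝ)) :=
  ⟨LZ77.greedy_upper_bound hed hel hec hε₀ hC, LZ77.greedy_lower_bound hed hel hec hε₀ hε₁ hC⟩
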